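/- **Upper bound on the vortex contribution.** Identify $\mathbb R^2$ with $\mathbb C$, and let $\mathcal B_1$ be the open unit disc. Let $\Omega_0>0$ and $\delta>0$. For $\varepsilon>0$ put $\ell_\varepsilon=\delta\sqrt\varepsilon$, let $$\mathcal L=\{(m\ell_\varepsilon,n\ell_\varepsilon): m,n\in\mathbb Z\}\cap\{r\le 1-2\sqrt2\,\ell_\varepsilon\}$$ (a finite set of points $z_i$, $i \in \mathcal L$), and define the phase $$g_\varepsilon(z)=\prod_{i\in\mathcal L}\frac{z-z_i}{|z-z_i|}$$ and the vector potential $\vec A_\varepsilon(x,y)=\frac{\Omega_0}{2\varepsilon}(-y,x)$. For $\eta>0$ let $\Lambda=\Lambda_{\varepsilon,\eta}$ be $\mathcal B_1$ without the balls of radius $\varepsilon^\eta$ centered at the points $z_i$, $i\in\mathcal L$. There exist constants $C>0$ and $\varepsilon_0>0$, depending only on $\Omega_0$ and $\delta$, such that for all $\eta$ with $5/2<\eta<\infty$ and all $0<\varepsilon<\varepsilon_0$ the function $|(\nabla-i\vec A_\varepsilon)g_\varepsilon|^2$ is integrable on $\Lambda$ and $$\int_\Lambda\left|(\nabla-i\vec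 A_\varepsilon)g_\varepsilon\right|^2 d\vec r\;\le\;\frac{\pi}{2\varepsilon^2}\left(\frac{\Omega_0}{2}-\frac{\pi}{\delta^2}\right)^2+\frac{C\,\eta\,|\log\varepsilon|}{\varepsilon}.$$ In particular, for fixed $\eta$ the remainder is $O(|\log\varepsilon|/\varepsilon)$. -/

import Mathlib

open MeasureTheory

noncomputable section

/- The plane `ℝ²` is identified with `ℂ` by `z = x + i y`; the measure on `ℂ` is Lebesgue measure. -/

/-- The points of the square lattice `ℓ ℤ²` at distance at most `1 - 2 √2 ℓ` from the origin. -/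
def vortexLattice (ℓ : ℝ) : Set ℂ :=
  {z | (∃ m n : ℤ, z = (⟨m * ℓ, n * ℓ⟩ : ℂ)) ∧ ‖z‖ ≤ 1 - 2 * √2 * ℓ}

/-- The lattice has finitely many points, so that the product in `vortexPhase` is a true product. -/
theorem vortexLattice_finite {ℓ : ℝ} (hℓ : 0 < ℓ) : (vortexLattice ℓ).Finite := by
  have key : ∀ (k : ℤ), |(k : ℝ) * ℓ| ≤ 1 - 2 * √2 * ℓ → k ∈ Set.Icc (-⌈1 / ℓ⌉) ⌈1 / ℓ⌉ := by
    intro k hk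
    have h1 : |(k : ℝ)| * ℓ ≤ 1 := by
      rw [abs_mul, abs_of_pos hℓ] at hk
      have : 0 ≤ 2 * √2 * ℓ := by positivity
      linarith
    have h2 : |(k : ℝ)| ≤ ⌈1 / ℓ⌉ := ((le_div_iff₀ hℓ).2 h1).trans (Int.le_ceil _)
    have h3 : |k| ≤ ⌈1 / ℓ⌉ := by exact_mod_cast h2
    exact abs_le.1 h3
  refine (((Set.finite_Icc (-⌈1 / ℓ⌉) ⌈1 / ℓ⌉).prod (Set.finite_Icc (-⌈1 / ℓ⌉) ⌈1 / ℓ⌉)).image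
    (fun p : ℤ × ℤ => (⟨p.1 * ℓ, p.2 * ℓ⟩ : ℂ))).subset ?_
  rintro z ⟨⟨m, n, rfl⟩, hz⟩
  exact ⟨(m, n), ⟨key m ((Complex.abs_re_le_norm _).trans hz),
    key n ((Complex.abs_im_le_norm _).trans hz)⟩, rfl⟩

/-- The phase `g(z) = ∏ (z - w) / |z - w|`, the product being over the lattice points `w`. -/
def vortexPhase (ℓ : ℝ) (z : ℂ) : ℂ :=
  ∏ᶠ w ∈ vortexLattice ℓ, (z - w) / (‖z - w‖ : ℂ)

/-- The open unit disc without the balls of radius `a` around the lattice points. -/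
def perforatedDisc (ℓ a : ℝ) : Set ℂ :=
  Metric.ball 0 1 \ ⋃ w ∈ vortexLattice ℓ, Metric.ball w a

/-- The vector potential `(Ω / 2) ẑ × r = (Ω / 2) (-y, x)` of a rotation with angular velocity `Ω`. -/
def rotationPotential (Ω : ℝ) (z : ℂ) : ℝ × ℝ :=
  (Ω / 2 * -z.im, Ω / 2 * z.re)

/-- The density `|(∇ - i A) ψ|² = |∂ₓψ - i A₁ ψ|² + |∂ᵧψ - i A₂ ψ|²` at the point `z`, where `A` is
the vector potential of angular velocity `Ω`. -/
def magneticDensity (Ω : ℝ) (ψ : ℂ → ℂ) (z : ℂ) : ℝ :=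
  ‖fderiv ℝ ψ z 1 - Complex.I * (rotationPotential Ω z).1 * ψ z‖ ^ 2
    + ‖fderiv ℝ ψ z Complex.I - Complex.I * (rotationPotential Ω z).2 * ψ z‖ ^ 2

end

/-! Away from the vortices `g` has modulus one and its logarithmic derivative along `v` is `i Im (v
∑ (z - w)⁻¹)`, so the density equals `|∑ (z - w)⁻¹ - (Ω / 2) conj z|²`. A charge of unit density on
the disc produces the field `π conj z` inside it (`setIntegral_ball_inv_sub`). The lattice has one
vortex per area `ℓ²`, so its field should be close to `(π / ℓ²) conj z`. With `f` the difference
(`vortexField`) and `c = π / ℓ² - Ω / 2`, the density is `|f|² + 2 c Re (z f) + c² |z|²`.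

The last term has integral at most `c² π / 2`; as `c` is a constant over `ε`, this is the leading
term. The other two must be `O(|log ε| / ε)`.

Energy of `f`: up to a boundary layer, `f` is a sum of fields of point charges, each screened by a
uniform charge on its own square cell (`vortexField_eq`). A cell has no net charge and no dipole
moment, so its field decays like `ℓ² / |z - w|³`, and all cells together give `O(1 / ℓ)` plus the
pole of a nearby vortex. The poles have energy `2π log (ℓ / 2a)` each, outside holes of radius `a`,
and there are at most `π / ℓ²` of them. The layer has width `O(ℓ)` and charge density `ℓ⁻²`; its
energy is `O(ℓ⁻⁴ ℓ²)` by `exists_lintegral_sq_lintegral_annulus_le`. In total this is `O((1 + log (ℓ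
/ 2a)) / ℓ²)`.

Cross term: since `c` may be of order `1 / ε`, Cauchy–Schwarz would not suffice; `∫ z f` itself has
to be bounded. Over the whole disc each pole contributes exactly `π (1 - |w|²)`, and summing over
the lattice is a midpoint rule whose error cancels the factor `ℓ⁻²`
(`norm_setIntegral_ball_mul_vortexField_le`). The holes change the integral by `O(a / ℓ⁴)`, which is
bounded because `a ≤ ε²`. -/

/-! ### Derivative of the phase and the magnetic density. -/

/-- The real-linear map `v ↦ i Im (v / (z - w))`: the logarithmic derivative of the phase
`(z - w) / |z - w|`. -/
noncomputable def phaseLogDeriv (w z : ℂ) : ℂ →L[ℝ] ℂ :=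
  Complex.I • (Complex.ofRealCLM.comp
    (Complex.imCLM.comp (ContinuousLinearMap.mul ℝ ℂ (z - w)⁻¹)))

theorem phaseLogDeriv_apply (w z v : ℂ) :
    phaseLogDeriv w z v = Complex.I * (((z - w)⁻¹ * v).im : ℂ) := by
  simp [phaseLogDeriv]

theorem hasFDerivAt_unitPhase {w z : ℂ} (h : z ≠ w) :
    HasFDerivAt (fun z : ℂ => (z - w) / (‖z - w‖ : ℂ))
      (((z - w) / (‖z - w‖ : ℂ)) • phaseLogDeriv w z) z := by
  have hz : z - w ≠ 0 := sub_ne_zero.2 h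
  have hsub : DifferentiableAt ℝ (fun z : ℂ => z - w) z := by fun_prop
  have hnorm : DifferentiableAt ℝ (fun z : ℂ => ‖z - w‖) z := hsub.norm ℝ hz
  have hn0 : (‖z - w‖ : ℂ) ≠ 0 := by simpa using hz
  have hcast : DifferentiableAt ℝ (fun z : ℂ => (‖z - w‖ : ℂ)) z :=
    Complex.ofRealCLM.differentiableAt.comp z hnorm
  have hu : DifferentiableAt ℝ (fun z : ℂ => (z - w) / (‖z - w‖ : ℂ)) z := by
    simp only [div_eq_mul_inv]
    exact hsub.fun_mul (hcast.fun_inv hn0)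
  have hd := hu.hasFDerivAt
  set u' := fderiv ℝ (fun z : ℂ => (z - w) / (‖z - w‖ : ℂ)) z with hu'
  -- With `p` the phase, `p² conj (y - w) = y - w` holds for every `y`. Differentiating it gives a
  -- linear equation for `p'`, solvable since `p` and `conj (z - w)` do not vanish; the norm is
  -- never differentiated explicitly.
  have key : ∀ y : ℂ, ((y - w) / (‖y - w‖ : ℂ)) ^ 2 * (starRingEnd ℂ) (y - w) = y - w := by
    intro y
    by_cases hy : y - w = 0
    · simp [hy]
    · have : (‖y - w‖ : ℂ) ≠ 0 := by simpa using hy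
      rw [div_pow, ← Complex.mul_conj']
      have h2 : (starRingEnd ℂ) (y - w) ≠ 0 := (map_ne_zero _).2 hy
      field_simp
  have hconj : HasFDerivAt (fun y : ℂ => (starRingEnd ℂ) (y - w))
      (Complex.conjCLE : ℂ →L[ℝ] ℂ) z :=
    (Complex.conjCLE : ℂ →L[ℝ] ℂ).hasFDerivAt.comp z ((hasFDerivAt_id z).sub_const w)
  have h1 := (hd.pow 2).mul hconj
  have h2 : HasFDerivAt (fun y : ℂ => y - w) (ContinuousLinearMap.id ℝ ℂ) z :=
    (hasFDerivAt_id z).sub_const w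
  have h3 := h1.unique (h2.congr_of_eventuallyEq (Filter.Eventually.of_forall key))
  have : u' = ((z - w) / (‖z - w‖ : ℂ)) • phaseLogDeriv w z := by
    refine ContinuousLinearMap.ext fun v => ?_
    have h4 := congrArg (fun L : ℂ →L[ℝ] ℂ => L v) h3
    have hk := key z
    have hcz : (starRingEnd ℂ) (z - w) ≠ 0 := (map_ne_zero _).2 hz
    have hu0 : (z - w) / (‖z - w‖ : ℂ) ≠ 0 := div_ne_zero hz hn0
    have him : Complex.I * (((z - w)⁻¹ * v).im : ℂ)
        = ((z - w)⁻¹ * v - ((starRingEnd ℂ) (z - w))⁻¹ * (starRingEnd ℂ) v) / 2 := by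
      rw [Complex.im_eq_sub_conj, map_mul, map_inv₀]
      field_simp
    rw [smul_apply, phaseLogDeriv_apply, him]
    simp only [add_apply, smul_apply, smul_eq_mul,
      ContinuousLinearMap.id_apply, ContinuousLinearEquiv.coe_coe, Complex.conjCLE_apply] at h4
    generalize (z - w) / (‖z - w‖ : ℂ) = p at *
    generalize (starRingEnd ℂ) (z - w) = m at *
    generalize z - w = x at *
    subst hk
    have h5 : p * (((p ^ 2 * m)⁻¹ * v - m⁻¹ * (starRingEnd ℂ) v) / 2)
        = (v - p ^ 2 * (starRingEnd ℂ) v) / (2 * p * m) := by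
      field_simp
    rw [smul_eq_mul, h5, eq_div_iff (by simp [hu0, hcz])]
    simp at h4
    linear_combination h4
  rwa [this] at hd

theorem hasFDerivAt_prod_unitPhase {s : Finset ℂ} {z : ℂ} (h : z ∉ s) :
    HasFDerivAt (fun z : ℂ => ∏ w ∈ s, (z - w) / (‖z - w‖ : ℂ))
      ((∏ w ∈ s, (z - w) / (‖z - w‖ : ℂ)) • ∑ w ∈ s, phaseLogDeriv w z) z := by
  induction s using Finset.induction_on with
  | empty => simpa using hasFDerivAt_const (1 : ℂ) z
  | insert a s ha ih =>
    simp only [Finset.mem_insert, not_or] at h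
    simp_rw [Finset.prod_insert ha, Finset.sum_insert ha]
    convert! (hasFDerivAt_unitPhase h.1).mul (ih h.2) using 1
    rw [smul_add, smul_smul, smul_smul, mul_comm (∏ w ∈ s, (z - w) / (‖z - w‖ : ℂ)), add_comm]

theorem norm_prod_unitPhase {s : Finset ℂ} {z : ℂ} (h : z ∉ s) :
    ‖∏ w ∈ s, (z - w) / (‖z - w‖ : ℂ)‖ = 1 := by
  rw [norm_prod]
  refine Finset.prod_eq_one fun w hw => ?_
  have : ‖z - w‖ ≠ 0 := by
    rw [norm_ne_zero_iff, sub_ne_zero]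
    rintro rfl
    exact h hw
  rw [norm_div, Complex.norm_real, norm_norm, div_self this]

/-- For the phase of a finite configuration, the magnetic density is the squared modulus of the
difference of the (conjugate) vortex field and the rotation field. -/
theorem magneticDensity_prod_unitPhase (Ω : ℝ) {s : Finset ℂ} {z : ℂ} (h : z ∉ s) :
    magneticDensity Ω (fun z : ℂ => ∏ w ∈ s, (z - w) / (‖z - w‖ : ℂ)) z
      = ‖∑ w ∈ s, (z - w)⁻¹ - (Ω / 2 : ℝ) * (starRingEnd ℂ) z‖ ^ 2 := by
  have hn := norm_prod_unitPhase h
  rw [magneticDensity, (hasFDerivAt_prod_unitPhase h).fderiv]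
  set g := ∏ w ∈ s, (z - w) / (‖z - w‖ : ℂ)
  have happ : ∀ v : ℂ, (g • ∑ w ∈ s, phaseLogDeriv w z) v
      = g * (Complex.I * (((∑ w ∈ s, (z - w)⁻¹) * v).im : ℂ)) := by
    intro v
    simp only [smul_apply, sum_apply,
      phaseLogDeriv_apply, smul_eq_mul, ← Finset.mul_sum, Finset.sum_mul, Complex.im_sum,
      Complex.ofReal_sum]
  rw [happ, happ]
  set G := ∑ w ∈ s, (z - w)⁻¹
  have e : ∀ a b : ℝ, ‖g * (Complex.I * (a : ℂ)) - Complex.I * (b : ℂ) * g‖ ^ 2 = (a - b) ^ 2 := by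
    intro a b
    have : g * (Complex.I * (a : ℂ)) - Complex.I * (b : ℂ) * g
        = g * (Complex.I * ((a - b : ℝ) : ℂ)) := by push_cast; ring
    rw [this, norm_mul, norm_mul, hn, Complex.norm_I, Complex.norm_real, one_mul, one_mul,
      Real.norm_eq_abs, sq_abs]
  rw [e, e, ← Complex.normSq_eq_norm_sq, Complex.normSq_apply]
  simp [rotationPotential]
  ring

theorem magneticDensity_vortexPhase (Ω : ℝ) {ℓ : ℝ} (hℓ : 0 < ℓ) {z : ℂ}
    (h : z ∉ vortexLattice ℓ) :
    magneticDensity Ω (vortexPhase ℓ) z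
      = ‖∑ w ∈ (vortexLattice_finite hℓ).toFinset, (z - w)⁻¹
          - (Ω / 2 : ℝ) * (starRingEnd ℂ) z‖ ^ 2 := by
  have : vortexPhase ℓ
      = fun z : ℂ => ∏ w ∈ (vortexLattice_finite hℓ).toFinset, (z - w) / (‖z - w‖ : ℂ) := by
    funext y
    rw [vortexPhase, finprod_mem_eq_finite_toFinset_prod]
  rw [this]
  exact magneticDensity_prod_unitPhase Ω (by simpa using h)

/-! ### Radial integrals and integrable singularities in the plane. -/

theorem integral_complex_fun_norm (f : ℝ → ℝ) :
    ∫ z : ℂ, f ‖z‖ = 2 * Real.pi * ∫ y in Set.Ioi (0 : ℝ), y * f y := by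
  rw [integral_fun_norm_addHaar volume f, Complex.finrank_real_complex]
  simp [Measure.real, Complex.volume_ball, mul_assoc]

theorem locallyIntegrable_norm_rpow {α : ℝ} (hα : α < 2) :
    LocallyIntegrable (fun z : ℂ => ‖z‖ ^ (-α)) := by
  refine locallyIntegrable_of_norm_le_rpow (α := α) (C := 1) (by simp) (by simpa using hα)
    (Filter.Eventually.of_forall fun z => ?_)
    (measurable_norm.pow_const _).aestronglyMeasurable
  rw [Real.norm_of_nonneg (by positivity), one_mul]

theorem integrableOn_norm_sub_rpow {α : ℝ} (hα : α < 2) (z : ℂ) {s : Set ℂ}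
    (hs : Bornology.IsBounded s) : IntegrableOn (fun u : ℂ => ‖z - u‖ ^ (-α)) s := by
  obtain ⟨R, hR⟩ := (Metric.isBounded_iff_subset_closedBall z).1 hs
  refine IntegrableOn.mono_set ?_ hR
  have h := (locallyIntegrable_norm_rpow hα).integrableOn_isCompact (isCompact_closedBall 0 R)
  have h2 := ((Measure.measurePreserving_sub_left volume z).integrableOn_comp_preimage
    (MeasurableEquiv.subLeft z).measurableEmbedding).2 h
  convert! h2 using 1
  ext u
  simp [dist_eq_norm, norm_sub_rev]

theorem integrableOn_inv_norm_sub (z : ℂ) {s : Set ℂ} (hs : Bornology.IsBounded s) :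
    IntegrableOn (fun u : ℂ => ‖z - u‖⁻¹) s := by
  simpa [Real.rpow_neg_one] using integrableOn_norm_sub_rpow (α := 1) (by norm_num) z hs

theorem integrableOn_inv_sub (z : ℂ) {s : Set ℂ} (hs : Bornology.IsBounded s) :
    IntegrableOn (fun u : ℂ => (z - u)⁻¹) s := by
  refine (integrableOn_inv_norm_sub z hs).mono' (by fun_prop) (Filter.Eventually.of_forall ?_)
  intro u
  rw [norm_inv]

theorem integrableOn_inv_sub' (z : ℂ) {s : Set ℂ} (hs : Bornology.IsBounded s) :
    IntegrableOn (fun u : ℂ => (u - z)⁻¹) s := by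
  convert (integrableOn_inv_sub z hs).neg using 2 with u
  rw [Pi.neg_apply, ← inv_neg, neg_sub]

theorem setIntegral_ball_fun_norm_sub (f : ℝ → ℝ) (z : ℂ) (ρ : ℝ) :
    ∫ u in Metric.ball z ρ, f ‖z - u‖ = 2 * Real.pi * ∫ y in Set.Ioo 0 ρ, y * f y := by
  have h1 : ∫ u in Metric.ball z ρ, f ‖z - u‖
      = ∫ u : ℂ, (Set.Iio ρ).indicator f ‖z - u‖ := by
    rw [← integral_indicator measurableSet_ball]
    congr 1 with u
    simp only [Set.indicator, Metric.mem_ball', dist_eq_norm, Set.mem_Iio]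
  rw [h1, integral_sub_left_eq_self (fun u : ℂ => (Set.Iio ρ).indicator f ‖u‖) volume z,
    integral_complex_fun_norm]
  congr 1
  have h2 : ∀ y : ℝ, y * (Set.Iio ρ).indicator f y = (Set.Iio ρ).indicator (fun y => y * f y) y := by
    intro y
    simp [Set.indicator]
  simp_rw [h2]
  rw [setIntegral_indicator measurableSet_Iio, Set.Ioi_inter_Iio]

theorem setIntegral_ball_inv_norm_sub (z : ℂ) {ρ : ℝ} (hρ : 0 ≤ ρ) :
    ∫ u in Metric.ball z ρ, ‖z - u‖⁻¹ = 2 * Real.pi * ρ := by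
  rw [setIntegral_ball_fun_norm_sub (fun y => y⁻¹)]
  congr 1
  rw [setIntegral_congr_fun measurableSet_Ioo (g := fun _ => (1 : ℝ))
    (fun y hy => mul_inv_cancel₀ hy.1.ne')]
  simp [hρ]

theorem setIntegral_ball_norm_sq : ∫ z in Metric.ball (0 : ℂ) 1, ‖z‖ ^ 2 = Real.pi / 2 := by
  have := setIntegral_ball_fun_norm_sub (fun y => y ^ 2) 0 1
  simp only [zero_sub, norm_neg] at this
  rw [this, ← integral_Ioc_eq_integral_Ioo, ← intervalIntegral.integral_of_le zero_le_one]
  have : ∀ y : ℝ, y * y ^ 2 = y ^ 3 := fun y => by ring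
  simp_rw [this, integral_pow]
  norm_num
  ring

theorem setIntegral_annulus_inv_norm_sub_sq (z : ℂ) {a b : ℝ} (ha : 0 < a) (hab : a ≤ b) :
    ∫ u in Metric.ball z b \ Metric.ball z a, (‖z - u‖ ^ 2)⁻¹
      = 2 * Real.pi * Real.log (b / a) := by
  have h1 : ∫ u in Metric.ball z b \ Metric.ball z a, (‖z - u‖ ^ 2)⁻¹
      = ∫ u in Metric.ball z b, (Set.Ici a).indicator (fun y : ℝ => (y ^ 2)⁻¹) ‖z - u‖ := by
    rw [Set.sdiff_eq, ← setIntegral_indicator measurableSet_ball.compl]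
    congr 1 with u
    simp only [Set.indicator, Set.mem_compl_iff, Metric.mem_ball', dist_eq_norm, not_lt,
      Set.mem_Ici]
  rw [h1, setIntegral_ball_fun_norm_sub]
  congr 1
  have h2 : ∀ y : ℝ, y * (Set.Ici a).indicator (fun y : ℝ => (y ^ 2)⁻¹) y
      = (Set.Ici a).indicator (fun y => y⁻¹) y := by
    intro y
    by_cases hy : a ≤ y
    · have : y ≠ 0 := (ha.trans_le hy).ne'
      simp only [Set.indicator, Set.mem_Ici, hy, if_true]
      field_simp
    · simp [Set.indicator, hy]
  simp_rw [h2]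
  rw [setIntegral_indicator measurableSet_Ici, ← integral_inv_of_pos ha (ha.trans_le hab),
    intervalIntegral.integral_of_le hab, integral_Ioc_eq_integral_Ioo,
    ← integral_Ico_eq_integral_Ioo]
  congr 2
  ext y
  simp only [Set.mem_inter_iff, Set.mem_Ioo, Set.mem_Ici, Set.mem_Ico]
  exact ⟨fun h => ⟨h.2, h.1.2⟩, fun h => ⟨⟨ha.trans_le h.1, h.2⟩, h.1⟩⟩

/-- Split at distance `ρ` from the pole. The radius is free: it is taken to be `ℓ` for a cell and
`a` for the holes. -/
theorem setIntegral_inv_norm_sub_le (z : ℂ) {s : Set ℂ} (hs : Bornology.IsBounded s)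
    (hm : MeasurableSet s) {ρ : ℝ} (hρ : 0 < ρ) :
    ∫ u in s, ‖z - u‖⁻¹ ≤ volume.real s / ρ + 2 * Real.pi * ρ := by
  have hi := integrableOn_inv_norm_sub z hs
  rw [← integral_inter_add_sdiff measurableSet_ball hi (t := Metric.ball z ρ), add_comm]
  refine add_le_add ?_ ?_
  · have hfin : volume (s \ Metric.ball z ρ) < ⊤ := (hs.subset Set.sdiff_subset).measure_lt_top
    calc ∫ u in s \ Metric.ball z ρ, ‖z - u‖⁻¹
        ≤ ∫ u in s \ Metric.ball z ρ, ρ⁻¹ := by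
          refine setIntegral_mono_on (hi.mono_set Set.sdiff_subset) (by simp [hfin])
            (hm.diff measurableSet_ball) fun u hu => ?_
          have := hu.2
          rw [Metric.mem_ball', dist_eq_norm, not_lt] at this
          gcongr
      _ = volume.real (s \ Metric.ball z ρ) / ρ := by simp [div_eq_mul_inv]
      _ ≤ volume.real s / ρ := by
          gcongr
          · exact hs.measure_lt_top.ne
          · exact Set.sdiff_subset
  · rw [← setIntegral_ball_inv_norm_sub z hρ.le]
    refine setIntegral_mono_set (integrableOn_inv_norm_sub z Metric.isBounded_ball)
      (Filter.Eventually.of_forall fun u => by positivity)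
      (Filter.Eventually.of_forall fun u hu => hu.2)

/-- Scaling by `ℓ` gives `ℓ⁻³ · ℓ²`; the exponent 3 exceeds the dimension. This integral dominates
the sum of the tails of all cell fields. -/
theorem exists_integral_add_norm_sub_rpow :
    ∃ K : ℝ, 0 ≤ K ∧ ∀ (ℓ : ℝ) (z : ℂ), 0 < ℓ →
      Integrable (fun u : ℂ => ((ℓ + ‖z - u‖) ^ 3)⁻¹) ∧
        ∫ u : ℂ, ((ℓ + ‖z - u‖) ^ 3)⁻¹ = K / ℓ := by
  have h0 : Integrable (fun u : ℂ => ((1 + ‖u‖) ^ 3)⁻¹) := by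
    have := integrable_one_add_norm (E := ℂ) (μ := volume) (r := 3) (by simp; norm_num)
    convert this using 2 with u
    rw [Real.rpow_neg (by positivity)]
    norm_cast
  refine ⟨∫ u : ℂ, ((1 + ‖u‖) ^ 3)⁻¹, integral_nonneg fun u => by positivity, fun ℓ z hℓ => ?_⟩
  have h1 : (fun u : ℂ => ((ℓ + ‖u‖) ^ 3)⁻¹)
      = fun u => (ℓ ^ 3)⁻¹ * ((1 + ‖ℓ⁻¹ • u‖) ^ 3)⁻¹ := by
    funext u
    rw [norm_smul, ← mul_inv, ← mul_pow, mul_add, Real.norm_of_nonneg (by positivity),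
      mul_inv_cancel_left₀ hℓ.ne', mul_one]
  have h2 : Integrable (fun u : ℂ => ((ℓ + ‖u‖) ^ 3)⁻¹) := by
    rw [h1]
    exact (h0.comp_smul (inv_ne_zero hℓ.ne')).const_mul _
  refine ⟨h2.comp_sub_left z, ?_⟩
  rw [integral_sub_left_eq_self (fun u : ℂ => ((ℓ + ‖u‖) ^ 3)⁻¹) volume z, h1,
    integral_const_mul, Measure.integral_comp_smul volume (fun u : ℂ => ((1 + ‖u‖) ^ 3)⁻¹)]
  simp [abs_of_pos hℓ]
  field_simp

/-! ### Circle averages and the Cauchy transform of the disc. -/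

theorem setIntegral_ball_eq_circleAverage {f : ℂ → ℂ} {R : ℝ} (hm : Measurable f)
    (hf : IntegrableOn f (Metric.ball 0 R)) :
    ∫ z in Metric.ball 0 R, f z
      = ∫ r in Set.Ioo 0 R, (2 * Real.pi * r) • Real.circleAverage f 0 r := by
  set F := (Metric.ball (0 : ℂ) R).indicator f with hF
  have hFm : Measurable F := hm.indicator measurableSet_ball
  have hFi : Integrable F := (integrable_indicator_iff measurableSet_ball).2 hf
  have hsymm : ∀ r θ : ℝ, Complex.polarCoord.symm (r, θ) = circleMap 0 r θ := by
    intro r θ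
    simp [circleMap, Complex.exp_mul_I]
  have hcont : Continuous fun p : ℝ × ℝ => Complex.polarCoord.symm p := by
    simp_rw [Complex.polarCoord_symm_apply]
    fun_prop
  -- Fubini needs integrability in polar coordinates; it is transferred from the plane by the change
  -- of variables for `∫⁻`.
  have hint : IntegrableOn (fun p : ℝ × ℝ => p.1 • F (Complex.polarCoord.symm p))
      (Set.Ioi (0 : ℝ) ×ˢ Set.Ioo (-Real.pi) Real.pi) (volume.prod volume) := by
    refine ⟨(measurable_fst.smul (hFm.comp hcont.measurable)).aestronglyMeasurable, ?_⟩
    have h1 := Complex.lintegral_comp_polarCoord_symm (fun z => ‖F z‖ₑ)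
    rw [HasFiniteIntegral]
    refine lt_of_eq_of_lt ?_ (h1.trans_lt hFi.2)
    refine setLIntegral_congr_fun (measurableSet_Ioi.prod measurableSet_Ioo) fun p hp => ?_
    have hp1 : 0 < p.1 := hp.1
    simp only [smul_eq_mul]
    rw [enorm_smul, Real.enorm_of_nonneg hp1.le]
  rw [← integral_indicator measurableSet_ball, ← hF, ← Complex.integral_comp_polarCoord_symm]
  change ∫ p in Set.Ioi (0 : ℝ) ×ˢ Set.Ioo (-Real.pi) Real.pi, _ ∂(volume.prod volume) = _
  rw [setIntegral_prod _ hint]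
  have h2 : ∀ r ∈ Set.Ioi (0 : ℝ), ∫ θ in Set.Ioo (-Real.pi) Real.pi,
      r • F (Complex.polarCoord.symm (r, θ))
      = (Set.Iio R).indicator (fun r => (2 * Real.pi * r) • Real.circleAverage f 0 r) r := by
    intro r hr
    have hr0 : 0 < r := hr
    by_cases hrR : r < R
    · rw [Set.indicator_of_mem (by exact hrR), Real.circleAverage_eq_integral_add (-Real.pi),
        integral_smul, ← integral_Ioc_eq_integral_Ioo,
        ← intervalIntegral.integral_of_le (by linarith [Real.pi_pos]), smul_smul,
        intervalIntegral.integral_comp_add_right (fun θ => f (circleMap 0 r θ))]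
      have : 2 * Real.pi * r * (2 * Real.pi)⁻¹ = r := by field_simp
      rw [this]
      congr 1
      have e1 : 0 + -Real.pi = -Real.pi := by ring
      have e2 : 2 * Real.pi + -Real.pi = Real.pi := by ring
      rw [e1, e2]
      refine intervalIntegral.integral_congr fun θ _ => ?_
      rw [hsymm, hF, Set.indicator_of_mem]
      simp [abs_of_pos hr0, hrR]
    · rw [Set.indicator_of_notMem (by exact hrR)]
      refine integral_eq_zero_of_ae (Filter.Eventually.of_forall fun θ => ?_)
      simp only [Pi.zero_apply]
      rw [hsymm, hF, Set.indicator_of_notMem, smul_zero]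
      simp [abs_of_pos hr0]
      exact not_lt.1 hrR
  rw [setIntegral_congr_fun measurableSet_Ioi h2, setIntegral_indicator measurableSet_Iio,
    Set.Ioi_inter_Iio]

theorem circleAverage_inv_sub_of_lt {z : ℂ} {r : ℝ} (hr : 0 < r) (h : r < ‖z‖) :
    Real.circleAverage (fun u => (z - u)⁻¹) 0 r = z⁻¹ := by
  have hne : ∀ u ∈ Metric.closedBall (0 : ℂ) r, z - u ≠ 0 := by
    intro u hu h0
    rw [sub_eq_zero] at h0
    subst h0
    simp at hu
    linarith
  have hd : DifferentiableOn ℂ (fun u => (z - u)⁻¹) (Metric.closedBall 0 r) := fun u hu =>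
    ((differentiableAt_id.const_sub z).inv (hne u hu)).differentiableWithinAt
  have := DiffContOnCl.circleAverage (c := 0) (R := r) (f := fun u => (z - u)⁻¹) (by
    rw [abs_of_pos hr]
    exact hd.diffContOnCl_ball subset_rfl)
  simpa using this

theorem circleAverage_inv_sub_of_gt {z : ℂ} {r : ℝ} (h : ‖z‖ < r) :
    Real.circleAverage (fun u => (z - u)⁻¹) 0 r = 0 := by
  have hr : 0 < r := (norm_nonneg z).trans_lt h
  -- On the circle `r² = u conj u`, so `(z - u)⁻¹` is there the conjugate of `q u`. Since `|z| < r`,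
  -- `q` is holomorphic on the closed disc, and the mean value property returns `q 0 = 0`.
  set q : ℂ → ℂ := fun u => u / ((starRingEnd ℂ) z * u - (r : ℂ) ^ 2) with hq
  have hne : ∀ u ∈ Metric.closedBall (0 : ℂ) r, (starRingEnd ℂ) z * u - (r : ℂ) ^ 2 ≠ 0 := by
    intro u hu h0
    rw [sub_eq_zero] at h0
    have h1 := congrArg norm h0
    simp at h1 hu
    nlinarith [norm_nonneg z, norm_nonneg u]
  have hd : DifferentiableOn ℂ q (Metric.closedBall 0 r) := fun u hu =>
    (DifferentiableAt.fun_div differentiableAt_id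
      ((differentiableAt_id.const_mul ((starRingEnd ℂ) z)).sub_const ((r : ℂ) ^ 2))
      (hne u hu)).differentiableWithinAt
  have h1 := DiffContOnCl.circleAverage (c := 0) (R := r) (f := q) (by
    rw [abs_of_pos hr]
    exact hd.diffContOnCl_ball subset_rfl)
  have h2 : Real.circleAverage (fun u => (z - u)⁻¹) 0 r
      = Real.circleAverage (fun u => (starRingEnd ℂ) (q u)) 0 r := by
    refine Real.circleAverage_congr_sphere fun u hu => ?_
    rw [abs_of_pos hr] at hu
    have hu' : ‖u‖ = r := by simpa using hu
    have hu0 : u ≠ 0 := by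
      rw [← norm_pos_iff, hu']
      exact hr
    have hr2 : (r : ℂ) ^ 2 = u * (starRingEnd ℂ) u := by rw [Complex.mul_conj', hu']
    have hcu : (starRingEnd ℂ) u ≠ 0 := (map_ne_zero _).2 hu0
    simp only [hq, map_div₀, map_sub, map_mul, map_pow, Complex.conj_conj, Complex.conj_ofReal]
    rw [hr2, ← sub_mul, div_mul_cancel_right₀ hcu]
  have h3 := ContinuousLinearMap.circleAverage_comp_comm (c := 0) (R := r) (f := q)
    (Complex.conjCLE : ℂ →L[ℝ] ℂ) (by
      refine ContinuousOn.circleIntegrable hr.le (hd.continuousOn.mono Metric.sphere_subset_closedBall))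
  rw [h2]
  have h4 : Real.circleAverage (fun u => (starRingEnd ℂ) (q u)) 0 r
      = (starRingEnd ℂ) (Real.circleAverage q 0 r) := h3
  rw [h4, h1]
  simp [hq]

/-- The Cauchy transform of the unit disc. -/
theorem setIntegral_ball_inv_sub {z : ℂ} (hz : ‖z‖ < 1) :
    ∫ u in Metric.ball (0 : ℂ) 1, (z - u)⁻¹ = Real.pi * (starRingEnd ℂ) z := by
  rw [setIntegral_ball_eq_circleAverage (by fun_prop)
    (integrableOn_inv_sub z Metric.isBounded_ball)]
  have h1 : ∀ᵐ r : ℝ, r ∈ Set.Ioo (0 : ℝ) 1 →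
      (2 * Real.pi * r) • Real.circleAverage (fun u => (z - u)⁻¹) 0 r
      = (Set.Iio ‖z‖).indicator (fun r : ℝ => (2 * Real.pi * r) • z⁻¹) r := by
    have : ∀ᵐ r : ℝ, r ≠ ‖z‖ := compl_mem_ae_iff.2 (measure_singleton _)
    filter_upwards [this] with r hr hr1
    rcases lt_or_gt_of_ne hr with h | h
    · rw [Set.indicator_of_mem (by exact h), circleAverage_inv_sub_of_lt hr1.1 h]
    · rw [Set.indicator_of_notMem (by simpa using h.le), circleAverage_inv_sub_of_gt h, smul_zero]
  rw [setIntegral_congr_ae measurableSet_Ioo h1, setIntegral_indicator measurableSet_Iio,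
    Set.Ioo_inter_Iio, min_eq_right hz.le, integral_smul_const, ← integral_Ioc_eq_integral_Ioo,
    ← intervalIntegral.integral_of_le (norm_nonneg z), intervalIntegral.integral_const_mul,
    integral_id]
  by_cases h0 : z = 0
  · simp [h0]
  · have : (starRingEnd ℂ) z = ((‖z‖ : ℂ)) ^ 2 / z := by
      rw [← Complex.mul_conj', mul_div_cancel_left₀ _ h0]
    rw [this, Complex.real_smul]
    push_cast
    field_simp
    ring

/-- Write `z / (z - w) = 1 - w / (w - z)` and apply the Cauchy transform at `w`. -/
theorem setIntegral_ball_mul_inv_sub {w : ℂ} (hw : ‖w‖ < 1) :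
    ∫ z in Metric.ball (0 : ℂ) 1, z * (z - w)⁻¹ = Real.pi * (1 - (‖w‖ : ℂ) ^ 2) := by
  have h1 : ∀ᵐ z : ℂ, z ∈ Metric.ball (0 : ℂ) 1 → z * (z - w)⁻¹ = 1 - w * (w - z)⁻¹ := by
    have : ∀ᵐ z : ℂ, z ≠ w := compl_mem_ae_iff.2 (measure_singleton _)
    filter_upwards [this] with z hz _
    have h2 : z - w ≠ 0 := sub_ne_zero.2 hz
    have h3 : w - z ≠ 0 := sub_ne_zero.2 hz.symm
    rw [← neg_sub z w, inv_neg]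
    field_simp
    ring
  have hone : Integrable (fun _ : ℂ => (1 : ℂ)) (volume.restrict (Metric.ball (0 : ℂ) 1)) :=
    integrableOn_const measure_ball_lt_top.ne
  rw [setIntegral_congr_ae measurableSet_ball h1, integral_sub hone
    ((integrableOn_inv_sub w Metric.isBounded_ball).const_mul w), integral_const_mul,
    setIntegral_ball_inv_sub hw, ← Complex.mul_conj']
  simp [Measure.real, Complex.volume_ball]
  ring

/-! ### Energy of a charge in a thin boundary layer. -/

open ENNReal in
theorem lintegral_ball_enorm_sub_rpow_lt_top :
    ∃ K : ℝ≥0∞, K ≠ ⊤ ∧ ∀ u ∈ Metric.ball (0 : ℂ) 1,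
      ∫⁻ z in Metric.ball (0 : ℂ) 1, ‖z - u‖ₑ ^ (-(3 / 2) : ℝ) ≤ K := by
  refine ⟨∫⁻ v in Metric.ball (0 : ℂ) 2, ‖v‖ₑ ^ (-(3 / 2) : ℝ), ?_, fun u hu => ?_⟩
  · have h1 := ((locallyIntegrable_norm_rpow (α := 3 / 2) (by norm_num)).integrableOn_isCompact
      (isCompact_closedBall 0 2)).mono_set Metric.ball_subset_closedBall
    refine (lt_of_eq_of_lt (lintegral_congr_ae ?_) h1.2).ne
    have : ∀ᵐ v : ℂ, v ≠ 0 := compl_mem_ae_iff.2 (measure_singleton _)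
    filter_upwards [ae_restrict_of_ae this] with v hv
    have hv' : 0 < ‖v‖ := norm_pos_iff.2 hv
    rw [Real.enorm_of_nonneg (by positivity), ← ENNReal.ofReal_rpow_of_pos hv', ofReal_norm]
  · have h2 := (measurePreserving_sub_right volume u).setLIntegral_comp_preimage
      (s := Metric.ball (0 : ℂ) 2) (f := fun v : ℂ => ‖v‖ₑ ^ (-(3 / 2) : ℝ)) measurableSet_ball
      (by fun_prop)
    rw [← h2]
    refine lintegral_mono_set fun z hz => ?_
    simp only [Metric.mem_ball, dist_zero_right, Set.mem_preimage] at *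
    linarith [norm_sub_le z u]

/-- The distance is at least `r |sin (θ / 2)|`, and Jordan's inequality bounds the sine below. The
bound does not involve `ρ`, which makes the annulus estimate uniform in the pole. -/
theorem norm_sub_circleMap_ge {ρ r θ : ℝ} (hρ : 0 ≤ ρ) (hr : 0 ≤ r) (hθ : |θ| ≤ Real.pi) :
    r * |θ| / Real.pi ≤ ‖(ρ : ℂ) - circleMap 0 r θ‖ := by
  have h1 : |θ| / Real.pi ≤ |Real.sin (θ / 2)| := by
    have := Real.mul_abs_le_abs_sin (x := θ / 2) (by rw [abs_div, abs_two]; linarith)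
    rw [abs_div, abs_two] at this
    calc |θ| / Real.pi = 2 / Real.pi * (|θ| / 2) := by ring
      _ ≤ _ := this
  have h2 : (r * Real.sin (θ / 2)) ^ 2 ≤ ‖(ρ : ℂ) - circleMap 0 r θ‖ ^ 2 := by
    have hc : Real.cos θ = 1 - 2 * Real.sin (θ / 2) ^ 2 := by
      have h := Real.cos_two_mul (θ / 2)
      rw [mul_div_cancel₀ θ two_ne_zero] at h
      rw [h, Real.sin_sq]
      ring
    have hs := Real.sin_sq_add_cos_sq θ
    have he : ‖(ρ : ℂ) - circleMap 0 r θ‖ ^ 2 = (ρ - r * Real.cos θ) ^ 2 + (r * Real.sin θ) ^ 2 := by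
      rw [← Complex.normSq_eq_norm_sq, Complex.normSq_apply]
      simp [circleMap, Complex.exp_mul_I, ← Complex.ofReal_cos, ← Complex.ofReal_sin]
      ring
    rw [he]
    have hS0 := sq_nonneg (Real.sin (θ / 2))
    have hS1 : Real.sin (θ / 2) ^ 2 ≤ 1 := Real.sin_sq_le_one _
    rw [mul_pow]
    generalize Real.sin (θ / 2) ^ 2 = S at *
    have h3 : (ρ - r * Real.cos θ) ^ 2 + (r * Real.sin θ) ^ 2
        = ρ ^ 2 - 2 * (ρ * r) * (1 - 2 * S) + r ^ 2 := by
      rw [hc] at hs ⊢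
      linear_combination r ^ 2 * hs
    rw [h3]
    have hρr := mul_nonneg hρ hr
    -- For `S ≤ 1/2`, completing the square leaves `4 S (1 - S) r² ≥ S r²`; for `S ≥ 1/2` the mixed
    -- term is nonnegative and `r² ≥ S r²`.
    rcases le_total S (1 / 2) with h | h
    · nlinarith [sq_nonneg (ρ - r * (1 - 2 * S)), mul_nonneg (sq_nonneg r)
        (mul_nonneg hS0 (sub_nonneg.2 h))]
    · nlinarith [mul_nonneg (sq_nonneg r) (sub_nonneg.2 hS1), mul_nonneg hρr (sub_nonneg.2 h),
        sq_nonneg ρ]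
  calc r * |θ| / Real.pi = r * (|θ| / Real.pi) := by ring
    _ ≤ r * |Real.sin (θ / 2)| := by gcongr
    _ = |r * Real.sin (θ / 2)| := by rw [abs_mul, abs_of_nonneg hr]
    _ ≤ |‖(ρ : ℂ) - circleMap 0 r θ‖| := sq_le_sq.1 h2
    _ = _ := abs_norm _

-- In polar coordinates the integrand is at most a function of the angle with an integrable
-- singularity `|θ|^(-1/2)`, so the radial integration contributes the full factor `t`. The
-- assumption `t ≤ 1 / 2` keeps `r ≥ 1 / 2`.
open ENNReal in
theorem exists_lintegral_annulus_enorm_sub_rpow_le :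
    ∃ K : ℝ≥0∞, K ≠ ⊤ ∧ ∀ (z : ℂ) (t : ℝ), 0 < t → t ≤ 1 / 2 →
      ∫⁻ u in Metric.ball (0 : ℂ) 1 \ Metric.closedBall 0 (1 - t), ‖z - u‖ₑ ^ (-(1 / 2) : ℝ)
        ≤ K * ENNReal.ofReal t := by
  set J : ℝ → ℝ≥0∞ := fun θ => ENNReal.ofReal (|θ| / (2 * Real.pi)) ^ (-(1 / 2) : ℝ) with hJ
  have hJm : Measurable J := by fun_prop
  refine ⟨∫⁻ θ in Set.Ioo (-Real.pi) Real.pi, J θ, ?_, ?_⟩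
  · have h1 : IntegrableOn (fun θ : ℝ => |θ| ^ (-(1 / 2) : ℝ)) (Set.Ioo (-Real.pi) Real.pi) := by
      refine IntegrableOn.mono_set ?_ Set.Ioo_subset_Icc_self
      refine LocallyIntegrable.integrableOn_isCompact ?_ isCompact_Icc
      refine locallyIntegrable_of_norm_le_rpow (α := 1 / 2) (C := 1) (by simp)
        (by simp; norm_num) (Filter.Eventually.of_forall fun θ => ?_)
        ((measurable_norm (α := ℝ)).pow_const _).aestronglyMeasurable
      rw [Real.norm_of_nonneg (by positivity), one_mul, Real.norm_eq_abs]
    have h2 := h1.const_mul ((2 * Real.pi)⁻¹ ^ (-(1 / 2) : ℝ))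
    refine (lt_of_eq_of_lt (lintegral_congr_ae ?_) h2.2).ne
    have : ∀ᵐ v : ℝ, v ≠ 0 := compl_mem_ae_iff.2 (measure_singleton _)
    filter_upwards [ae_restrict_of_ae this] with θ hv
    have hv' : 0 < |θ| := abs_pos.2 hv
    have hpi := Real.pi_pos
    rw [Real.enorm_of_nonneg (by positivity), ← Real.mul_rpow (by positivity) (by positivity), hJ]
    simp only
    rw [ENNReal.ofReal_rpow_of_pos (by positivity), div_eq_inv_mul]
  -- the case of a nonnegative real point
  have hreal : ∀ (ρ t : ℝ), 0 ≤ ρ → 0 < t → t ≤ 1 / 2 →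
      ∫⁻ u in Metric.ball (0 : ℂ) 1 \ Metric.closedBall 0 (1 - t),
        ‖(ρ : ℂ) - u‖ₑ ^ (-(1 / 2) : ℝ)
        ≤ (∫⁻ θ in Set.Ioo (-Real.pi) Real.pi, J θ) * ENNReal.ofReal t := by
    intro ρ t hρ ht ht2
    have hSm : MeasurableSet (Metric.ball (0 : ℂ) 1 \ Metric.closedBall 0 (1 - t)) :=
      measurableSet_ball.diff measurableSet_closedBall
    have hinter : Set.Ioo (1 - t) 1 ∩ Set.Ioi 0 = Set.Ioo (1 - t) 1 :=
      Set.inter_eq_left.2 fun x hx => show (0 : ℝ) < x by linarith [hx.1]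
    rw [← lintegral_indicator hSm, ← Complex.lintegral_comp_polarCoord_symm]
    calc _ ≤ ∫⁻ p in Set.Ioi (0 : ℝ) ×ˢ Set.Ioo (-Real.pi) Real.pi,
          (Set.Ioo (1 - t) 1).indicator (fun _ => (1 : ℝ≥0∞)) p.1 * J p.2 := by
          refine setLIntegral_mono (by
            refine Measurable.mul ?_ (hJm.comp measurable_snd)
            exact (measurable_const.indicator measurableSet_Ioo).comp measurable_fst) ?_
          rintro ⟨r, θ⟩ ⟨hr, hθ⟩
          have hr0 : 0 < r := hr
          have hθ' : |θ| < Real.pi := abs_lt.2 hθ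
          have hs : Complex.polarCoord.symm (r, θ) = circleMap 0 r θ := by
            simp [circleMap, Complex.exp_mul_I]
          rw [hs]
          by_cases hrt : r ∈ Set.Ioo (1 - t) 1
          · rw [Set.indicator_of_mem hrt, Set.indicator_of_mem, smul_eq_mul]
            · refine mul_le_mul' (ENNReal.ofReal_le_one.2 hrt.2.le) ?_
              rw [hJ]
              simp only
              rw [ENNReal.rpow_neg, ENNReal.rpow_neg, ENNReal.inv_le_inv, ← ofReal_norm]
              refine ENNReal.rpow_le_rpow ?_ (by norm_num)
              refine ENNReal.ofReal_le_ofReal (le_trans ?_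
                (norm_sub_circleMap_ge hρ hr0.le hθ'.le))
              have : 1 / 2 ≤ r := by linarith [hrt.1]
              calc |θ| / (2 * Real.pi) = 1 / 2 * |θ| / Real.pi := by field_simp
                _ ≤ _ := by gcongr
            · simp [abs_of_pos hr0, hrt.1, hrt.2]
          · rw [Set.indicator_of_notMem (s := Metric.ball (0 : ℂ) 1 \ _), smul_zero]
            · exact zero_le
            · simpa [abs_of_pos hr0, and_comm] using hrt
      _ = _ := by
          rw [Measure.volume_eq_prod, ← Measure.prod_restrict, lintegral_prod_mul
            (measurable_const.indicator measurableSet_Ioo).aemeasurable hJm.aemeasurable,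
            lintegral_indicator measurableSet_Ioo, Measure.restrict_restrict measurableSet_Ioo,
            hinter,
            setLIntegral_one, Real.volume_Ioo, mul_comm]
          simp
  intro z t ht ht2
  refine le_of_eq_of_le ?_ (hreal ‖z‖ t (norm_nonneg z) ht ht2)
  -- The annulus is rotation invariant, so `z` may be turned onto the positive real axis.
  have hmp := (rotation (Circle.exp z.arg)).measurePreserving
  rw [← hmp.setLIntegral_comp_preimage (by measurability) (by fun_prop)]
  have hpre : (rotation (Circle.exp z.arg)) ⁻¹'
      (Metric.ball (0 : ℂ) 1 \ Metric.closedBall 0 (1 - t))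
      = Metric.ball (0 : ℂ) 1 \ Metric.closedBall 0 (1 - t) := by
    ext u
    simp only [Set.mem_preimage, Set.mem_sdiff, Metric.mem_ball, Metric.mem_closedBall,
      dist_zero_right, LinearIsometryEquiv.norm_map]
  rw [hpre]
  refine lintegral_congr fun u => ?_
  congr 1
  have : z - rotation (Circle.exp z.arg) u = (Circle.exp z.arg : ℂ) * ((‖z‖ : ℂ) - u) := by
    rw [rotation_apply, mul_sub, Circle.coe_exp, mul_comm _ (‖z‖ : ℂ),
      Complex.norm_mul_exp_arg_mul_I]
  rw [this, ← ofReal_norm, ← ofReal_norm, norm_mul, Circle.norm_coe, one_mul]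

open ENNReal in
/-- The field of a charge of bounded density in a thin annulus along the unit circle has an energy
of the order of the square of the width. -/
theorem exists_lintegral_sq_lintegral_annulus_le :
    ∃ K : ℝ, 0 ≤ K ∧ ∀ (S : Set ℂ) (t : ℝ), 0 < t → t ≤ 1 / 2 → MeasurableSet S →
      S ⊆ Metric.ball (0 : ℂ) 1 \ Metric.closedBall 0 (1 - t) →
      ∫⁻ z in Metric.ball (0 : ℂ) 1, (∫⁻ u in S, ‖z - u‖ₑ⁻¹) ^ 2 ≤ ENNReal.ofReal (K * t ^ 2) := by
  obtain ⟨K₁, hK₁, h1⟩ := lintegral_ball_enorm_sub_rpow_lt_top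
  obtain ⟨K₂, hK₂, h2⟩ := exists_lintegral_annulus_enorm_sub_rpow_le
  refine ⟨(K₁ * K₂).toReal * (2 * Real.pi), by positivity, fun S t ht ht2 hS hSt => ?_⟩
  have hCS : ∀ z : ℂ, (∫⁻ u in S, ‖z - u‖ₑ⁻¹) ^ 2
      ≤ (∫⁻ u in S, ‖z - u‖ₑ ^ (-(3 / 2) : ℝ)) * (K₂ * ENNReal.ofReal t) := by
    intro z
    -- Cauchy–Schwarz with `1 = 3/4 + 1/4`: after squaring, the power `-1/2` gives a factor `t`
    -- uniformly in `z`, while `-3/2` is still integrable in `z` over the disc and leaves the area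
    -- of `S` as a second factor `t`.
    have hH := ENNReal.lintegral_mul_le_Lp_mul_Lq (volume.restrict S) Real.HolderConjugate.two_two
      (f := fun u => ‖z - u‖ₑ ^ (-(3 / 4) : ℝ)) (g := fun u => ‖z - u‖ₑ ^ (-(1 / 4) : ℝ))
      (by fun_prop) (by fun_prop)
    have e1 : ∀ x : ℝ≥0∞, x ^ (-(3 / 4) : ℝ) * x ^ (-(1 / 4) : ℝ) = x⁻¹ := by
      intro x
      rcases eq_or_ne x 0 with rfl | h0
      · norm_num [ENNReal.zero_rpow_of_neg]
      rcases eq_or_ne x ⊤ with rfl | ht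
      · norm_num [ENNReal.top_rpow_of_neg]
      rw [← ENNReal.rpow_add _ _ h0 ht, ← ENNReal.rpow_neg_one]
      norm_num
    simp only [Pi.mul_apply, e1, ← ENNReal.rpow_mul] at hH
    have h3 := pow_le_pow_left' hH 2
    refine h3.trans ?_
    rw [mul_pow, ← ENNReal.rpow_natCast, ← ENNReal.rpow_natCast, ← ENNReal.rpow_mul,
      ← ENNReal.rpow_mul]
    norm_num
    refine mul_le_mul' (by norm_num) (le_trans (lintegral_mono_set hSt) ?_)
    have := h2 z t ht ht2
    norm_num at this ⊢
    exact this
  have hvol : volume S ≤ ENNReal.ofReal (2 * Real.pi * t) := by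
    refine (measure_mono hSt).trans ?_
    rw [measure_sdiff (fun x hx => ?_) measurableSet_closedBall.nullMeasurableSet
      measure_closedBall_lt_top.ne, Complex.volume_ball, Complex.volume_closedBall]
    · have : (NNReal.pi : ℝ≥0∞) = ENNReal.ofReal Real.pi := by
        rw [← NNReal.coe_real_pi, ENNReal.ofReal_coe_nnreal]
      rw [this, ← ENNReal.ofReal_pow zero_le_one, ← ENNReal.ofReal_pow (by linarith),
        ← ENNReal.ofReal_mul (by positivity), ← ENNReal.ofReal_mul (by positivity),
        ← ENNReal.ofReal_sub _ (by positivity)]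
      refine ENNReal.ofReal_le_ofReal ?_
      nlinarith [Real.pi_pos, mul_pos Real.pi_pos (mul_pos ht ht)]
    · simp only [Metric.mem_ball, Metric.mem_closedBall] at *
      linarith
  calc _ ≤ ∫⁻ z in Metric.ball (0 : ℂ) 1,
        (∫⁻ u in S, ‖z - u‖ₑ ^ (-(3 / 2) : ℝ)) * (K₂ * ENNReal.ofReal t) :=
        lintegral_mono fun z => hCS z
    _ = (∫⁻ z in Metric.ball (0 : ℂ) 1, ∫⁻ u in S, ‖z - u‖ₑ ^ (-(3 / 2) : ℝ))
          * (K₂ * ENNReal.ofReal t) :=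
        lintegral_mul_const' _ _ (by finiteness)
    _ = (∫⁻ u in S, ∫⁻ z in Metric.ball (0 : ℂ) 1, ‖z - u‖ₑ ^ (-(3 / 2) : ℝ))
          * (K₂ * ENNReal.ofReal t) := by
        rw [lintegral_lintegral_swap (by fun_prop)]
    _ ≤ (∫⁻ u in S, K₁) * (K₂ * ENNReal.ofReal t) := by
        gcongr ?_ * _
        exact setLIntegral_mono measurable_const fun u hu => h1 u (hSt hu).1
    _ ≤ (K₁ * ENNReal.ofReal (2 * Real.pi * t)) * (K₂ * ENNReal.ofReal t) := by
        rw [setLIntegral_const]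
        gcongr
    _ = (K₁ * K₂) * (ENNReal.ofReal (2 * Real.pi * t) * ENNReal.ofReal t) := by ring
    _ = _ := by
        rw [← ENNReal.ofReal_mul (by positivity), ← ENNReal.ofReal_toReal (ENNReal.mul_ne_top hK₁ hK₂),
          ← ENNReal.ofReal_mul (by positivity), ENNReal.toReal_ofReal (by positivity)]
        congr 1
        ring

/-! ### Square cells and the fields of screened charges. -/

/-- The half-open square of side `ℓ` centred at `w`. -/
def latticeCell (ℓ : ℝ) (w : ℂ) : Set ℂ :=
  Complex.measurableEquivRealProd ⁻¹'
    (Set.Ico (w.re - ℓ / 2) (w.re + ℓ / 2) ×ˢ Set.Ico (w.im - ℓ / 2) (w.im + ℓ / 2))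

theorem mem_latticeCell {ℓ : ℝ} {w u : ℂ} :
    u ∈ latticeCell ℓ w ↔ (w.re - ℓ / 2 ≤ u.re ∧ u.re < w.re + ℓ / 2) ∧
      (w.im - ℓ / 2 ≤ u.im ∧ u.im < w.im + ℓ / 2) := Iff.rfl

theorem measurableSet_latticeCell (ℓ : ℝ) (w : ℂ) : MeasurableSet (latticeCell ℓ w) :=
  Complex.measurableEquivRealProd.measurable (measurableSet_Ico.prod measurableSet_Ico)

theorem norm_sub_le_of_mem_latticeCell {ℓ : ℝ} {w u : ℂ} (hu : u ∈ latticeCell ℓ w) :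
    ‖u - w‖ ≤ ℓ := by
  obtain ⟨⟨h1, h2⟩, h3, h4⟩ := mem_latticeCell.1 hu
  refine (Complex.norm_le_abs_re_add_abs_im _).trans ?_
  have h5 : |(u - w).re| ≤ ℓ / 2 := by
    rw [Complex.sub_re, abs_le]
    constructor <;> linarith
  have h6 : |(u - w).im| ≤ ℓ / 2 := by
    rw [Complex.sub_im, abs_le]
    constructor <;> linarith
  linarith

theorem isBounded_latticeCell (ℓ : ℝ) (w : ℂ) : Bornology.IsBounded (latticeCell ℓ w) :=
  Metric.isBounded_closedBall.subset fun u hu => by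
    simpa [dist_eq_norm] using norm_sub_le_of_mem_latticeCell hu

theorem volume_real_latticeCell {ℓ : ℝ} (hℓ : 0 ≤ ℓ) (w : ℂ) :
    volume.real (latticeCell ℓ w) = ℓ ^ 2 := by
  rw [measureReal_def, latticeCell, Complex.volume_preserving_equiv_real_prod.measure_preimage
    (measurableSet_Ico.prod measurableSet_Ico).nullMeasurableSet, Measure.volume_eq_prod,
    Measure.prod_prod, Real.volume_Ico, Real.volume_Ico, ← ENNReal.ofReal_mul (by linarith),
    ENNReal.toReal_ofReal (by nlinarith)]
  ring

theorem integrableOn_latticeCell {f : ℂ → ℂ} (hf : Continuous f) (ℓ : ℝ) (w : ℂ) :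
    IntegrableOn f (latticeCell ℓ w) :=
  (hf.continuousOn.integrableOn_compact (isCompact_closedBall w ℓ)).mono_set fun u hu => by
    simpa [dist_eq_norm] using norm_sub_le_of_mem_latticeCell hu

theorem setIntegral_latticeCell_mul (f g : ℝ → ℝ) (ℓ : ℝ) (w : ℂ) :
    ∫ u in latticeCell ℓ w, f u.re * g u.im
      = (∫ x in Set.Ico (w.re - ℓ / 2) (w.re + ℓ / 2), f x)
        * ∫ y in Set.Ico (w.im - ℓ / 2) (w.im + ℓ / 2), g y := by
  rw [← setIntegral_prod_mul, ← Measure.volume_eq_prod,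
    ← Complex.volume_preserving_equiv_real_prod.setIntegral_preimage_emb
      Complex.measurableEquivRealProd.measurableEmbedding]
  rfl

theorem setIntegral_Ico_sub_center {ℓ : ℝ} (hℓ : 0 ≤ ℓ) (c : ℝ) :
    ∫ x in Set.Ico (c - ℓ / 2) (c + ℓ / 2), (x - c) = 0 := by
  rw [integral_Ico_eq_integral_Ioc, ← intervalIntegral.integral_of_le (by linarith),
    intervalIntegral.integral_comp_sub_right (fun x => x), integral_id]
  ring

theorem setIntegral_latticeCell_sub_center {ℓ : ℝ} (hℓ : 0 ≤ ℓ) (w : ℂ) :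
    ∫ u in latticeCell ℓ w, (u - w) = 0 := by
  have hi : IntegrableOn (fun u : ℂ => u - w) (latticeCell ℓ w) :=
    integrableOn_latticeCell (by fun_prop) ℓ w
  have hre := setIntegral_latticeCell_mul (fun x => x - w.re) (fun _ => 1) ℓ w
  have him := setIntegral_latticeCell_mul (fun _ => 1) (fun x => x - w.im) ℓ w
  rw [setIntegral_Ico_sub_center hℓ] at hre him
  simp only [mul_one, one_mul, zero_mul, mul_zero] at hre him
  apply Complex.ext
  · rw [← Complex.reCLM_apply, ← Complex.reCLM.integral_comp_comm hi]
    simpa using hre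
  · rw [← Complex.imCLM_apply, ← Complex.imCLM.integral_comp_comm hi]
    simpa using him

/-- The field of a unit point charge at `w` screened by a uniform charge on its cell. -/
noncomputable def cellField (ℓ : ℝ) (w z : ℂ) : ℂ :=
  (z - w)⁻¹ - ((ℓ : ℂ) ^ 2)⁻¹ * ∫ u in latticeCell ℓ w, (z - u)⁻¹

theorem norm_cellField_le {ℓ : ℝ} (hℓ : 0 < ℓ) (w z : ℂ) :
    ‖cellField ℓ w z‖ ≤ ‖z - w‖⁻¹ + 8 / ℓ := by
  have h1 : ‖∫ u in latticeCell ℓ w, (z - u)⁻¹‖ ≤ 8 * ℓ := by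
    refine (norm_integral_le_integral_norm _).trans ?_
    simp_rw [norm_inv]
    refine (setIntegral_inv_norm_sub_le z (isBounded_latticeCell ℓ w)
      (measurableSet_latticeCell ℓ w) hℓ).trans ?_
    rw [volume_real_latticeCell hℓ.le]
    have : ℓ ^ 2 / ℓ = ℓ := by field_simp
    nlinarith [Real.pi_lt_d2]
  rw [cellField]
  refine (norm_sub_le _ _).trans ?_
  rw [norm_mul, norm_inv, norm_inv, norm_pow, Complex.norm_real, Real.norm_of_nonneg hℓ.le]
  have : (ℓ ^ 2)⁻¹ * (8 * ℓ) = 8 / ℓ := by field_simp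
  rw [← this]
  gcongr

/-- The charge of the cell cancels the point charge, and the dipole moment vanishes because `w` is
the centre of the cell; the second-order remainder of the expansion in `u - w` is left. -/
theorem norm_cellField_le_of_far {ℓ : ℝ} (hℓ : 0 < ℓ) {w z : ℂ} (h : 2 * ℓ ≤ ‖z - w‖) :
    ‖cellField ℓ w z‖ ≤ 2 * ℓ ^ 2 / ‖z - w‖ ^ 3 := by
  have hζ : z - w ≠ 0 := by
    rw [← norm_pos_iff]
    linarith
  have hfar : ∀ u ∈ latticeCell ℓ w, ‖z - w‖ / 2 ≤ ‖z - u‖ := by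
    intro u hu
    have h1 := norm_sub_le_of_mem_latticeCell hu
    have h2 := norm_add_le (z - u) (u - w)
    rw [sub_add_sub_cancel] at h2
    linarith
  have hne : ∀ u ∈ latticeCell ℓ w, z - u ≠ 0 := by
    intro u hu
    rw [← norm_pos_iff]
    linarith [hfar u hu]
  have hexp : ∀ u ∈ latticeCell ℓ w, (z - w)⁻¹ - (z - u)⁻¹
      = -((z - w) ^ 2)⁻¹ * (u - w) - (u - w) ^ 2 * ((z - w) ^ 2 * (z - u))⁻¹ := by
    intro u hu
    have := hne u hu
    field_simp
    ring
  have hfin : volume (latticeCell ℓ w) ≠ ⊤ := (isBounded_latticeCell ℓ w).measure_lt_top.ne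
  have hinv := integrableOn_inv_sub z (isBounded_latticeCell ℓ w)
  have hconst : IntegrableOn (fun _ : ℂ => (z - w)⁻¹) (latticeCell ℓ w) :=
    integrableOn_const hfin
  have hvol : (∫ _ in latticeCell ℓ w, (z - w)⁻¹) = (ℓ : ℂ) ^ 2 * (z - w)⁻¹ := by
    rw [setIntegral_const, volume_real_latticeCell hℓ.le, Complex.real_smul]
    push_cast
    rfl
  have hℓ0 : (ℓ : ℂ) ≠ 0 := by exact_mod_cast hℓ.ne'
  have h1 : cellField ℓ w z
      = ((ℓ : ℂ) ^ 2)⁻¹ * ∫ u in latticeCell ℓ w, ((z - w)⁻¹ - (z - u)⁻¹) := by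
    rw [integral_sub hconst hinv, hvol, cellField, mul_sub, inv_mul_cancel_left₀ (by positivity)]
  have hlin : IntegrableOn (fun u : ℂ => -((z - w) ^ 2)⁻¹ * (u - w)) (latticeCell ℓ w) :=
    integrableOn_latticeCell (by fun_prop) ℓ w
  have hquad : IntegrableOn (fun u : ℂ => (u - w) ^ 2 * ((z - w) ^ 2 * (z - u))⁻¹)
      (latticeCell ℓ w) := by
    have := hlin.sub (hconst.sub hinv)
    refine this.congr_fun (fun u hu => ?_) (measurableSet_latticeCell ℓ w)
    simp only [Pi.sub_apply]
    rw [hexp u hu]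
    ring
  have h2 : cellField ℓ w z = -(((ℓ : ℂ) ^ 2)⁻¹ *
      ∫ u in latticeCell ℓ w, (u - w) ^ 2 * ((z - w) ^ 2 * (z - u))⁻¹) := by
    rw [h1, setIntegral_congr_fun (measurableSet_latticeCell ℓ w) hexp, integral_sub hlin hquad,
      integral_const_mul, setIntegral_latticeCell_sub_center hℓ.le]
    ring
  have h3 : ‖∫ u in latticeCell ℓ w, (u - w) ^ 2 * ((z - w) ^ 2 * (z - u))⁻¹‖
      ≤ (ℓ ^ 2 * (‖z - w‖ ^ 2 * (‖z - w‖ / 2))⁻¹) * volume.real (latticeCell ℓ w) := by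
    refine norm_setIntegral_le_of_norm_le_const hfin.lt_top fun u hu => ?_
    rw [norm_mul, norm_inv, norm_mul, norm_pow, norm_pow]
    have := norm_sub_le_of_mem_latticeCell hu
    have := hfar u hu
    gcongr
  rw [volume_real_latticeCell hℓ.le] at h3
  rw [h2, norm_neg, norm_mul, norm_inv, norm_pow, Complex.norm_real, Real.norm_of_nonneg hℓ.le]
  have hζ' : ‖z - w‖ ≠ 0 := norm_ne_zero_iff.2 hζ
  calc (ℓ ^ 2)⁻¹ * ‖∫ u in latticeCell ℓ w, (u - w) ^ 2 * ((z - w) ^ 2 * (z - u))⁻¹‖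
      ≤ (ℓ ^ 2)⁻¹ * ((ℓ ^ 2 * (‖z - w‖ ^ 2 * (‖z - w‖ / 2))⁻¹) * ℓ ^ 2) := by gcongr
    _ = _ := by field_simp

/-- The tail is written as an integral over the cell itself, so that summing over disjoint cells
gives at most one integral over the plane. -/
theorem norm_cellField_le_add_integral {ℓ : ℝ} (hℓ : 0 < ℓ) (w z : ℂ) :
    ‖cellField ℓ w z‖ ≤ (if ‖z - w‖ < ℓ / 2 then ‖z - w‖⁻¹ else 0)
      + 10000 * ∫ u in latticeCell ℓ w, ((ℓ + ‖z - u‖) ^ 3)⁻¹ := by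
  have hlow : ∀ b : ℝ, 0 < b → (∀ u ∈ latticeCell ℓ w, ℓ + ‖z - u‖ ≤ b) →
      ℓ ^ 2 * (b ^ 3)⁻¹ ≤ ∫ u in latticeCell ℓ w, ((ℓ + ‖z - u‖) ^ 3)⁻¹ := by
    intro b hb hub
    obtain ⟨K, -, hK⟩ := exists_integral_add_norm_sub_rpow
    have h1 : ℓ ^ 2 * (b ^ 3)⁻¹ = ∫ u in latticeCell ℓ w, (b ^ 3)⁻¹ := by
      rw [setIntegral_const, volume_real_latticeCell hℓ.le, smul_eq_mul]
    rw [h1]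
    refine setIntegral_mono_on
      (integrableOn_const (isBounded_latticeCell ℓ w).measure_lt_top.ne)
      (hK ℓ z hℓ).1.integrableOn (measurableSet_latticeCell ℓ w) fun u hu => ?_
    have := hub u hu
    gcongr
  have htri : ∀ u ∈ latticeCell ℓ w, ‖z - u‖ ≤ ‖z - w‖ + ℓ := by
    intro u hu
    have h1 := norm_sub_le_of_mem_latticeCell hu
    have h2 := norm_sub_le (z - w) (u - w)
    rw [sub_sub_sub_cancel_right] at h2
    linarith
  have hc := norm_cellField_le hℓ w z
  split_ifs with hnear
  · have h1 := hlow (5 / 2 * ℓ) (by positivity) fun u hu => by linarith [htri u hu]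
    have h2 : ℓ ^ 2 * ((5 / 2 * ℓ) ^ 3)⁻¹ = 8 / 125 / ℓ := by
      field_simp
      norm_num
    rw [h2] at h1
    have h3 : 8 / ℓ = 125 * (8 / 125 / ℓ) := by ring
    have h4 : 0 ≤ 8 / 125 / ℓ := by positivity
    linarith
  · rw [not_lt] at hnear
    have hζ : 0 < ‖z - w‖ := by linarith
    have h1 := hlow (5 * ‖z - w‖) (by positivity) fun u hu => by linarith [htri u hu]
    have h2 : ℓ ^ 2 * ((5 * ‖z - w‖) ^ 3)⁻¹ = ℓ ^ 2 / ‖z - w‖ ^ 3 / 125 := by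
      field_simp
      norm_num
    rw [h2] at h1
    -- The value 80 comes from the range `ℓ / 2 ≤ |z - w| < 2ℓ`, where the bound is `10 / ℓ = 80 ℓ²
    -- / (2ℓ)³`; multiplied by `5³` it yields 10000.
    have h4 : ‖cellField ℓ w z‖ ≤ 80 * (ℓ ^ 2 / ‖z - w‖ ^ 3) := by
      rcases le_or_gt (2 * ℓ) ‖z - w‖ with h | h
      · refine (norm_cellField_le_of_far hℓ h).trans ?_
        have : 0 ≤ ℓ ^ 2 / ‖z - w‖ ^ 3 := by positivity
        rw [mul_div_assoc]
        linarith
      · refine hc.trans ?_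
        have h5 : ‖z - w‖⁻¹ ≤ 2 / ℓ := by
          rw [inv_le_comm₀ hζ (by positivity), inv_div]
          exact hnear
        have h6 : 10 / ℓ ≤ 80 * (ℓ ^ 2 / ‖z - w‖ ^ 3) := by
          calc 10 / ℓ = 80 * (ℓ ^ 2 / (2 * ℓ) ^ 3) := by
                field_simp
                norm_num
            _ ≤ _ := by gcongr
        have h7 : 10 / ℓ = 2 / ℓ + 8 / ℓ := by ring
        linarith
    linarith

/-! ### Tiling of the disc by the cells, up to a boundary layer. -/

theorem eq_of_mem_vortexLattice_of_abs_lt {ℓ : ℝ} (hℓ : 0 < ℓ) {w w' : ℂ}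
    (hw : w ∈ vortexLattice ℓ) (hw' : w' ∈ vortexLattice ℓ) (hre : |w.re - w'.re| < ℓ)
    (him : |w.im - w'.im| < ℓ) : w = w' := by
  obtain ⟨⟨m, n, rfl⟩, -⟩ := hw
  obtain ⟨⟨m', n', rfl⟩, -⟩ := hw'
  have key : ∀ a b : ℤ, |(a : ℝ) * ℓ - b * ℓ| < ℓ → a = b := by
    intro a b h
    rw [← sub_mul, abs_mul, abs_of_pos hℓ, mul_lt_iff_lt_one_left hℓ] at h
    have : |a - b| < 1 := by exact_mod_cast h
    rwa [Int.abs_lt_one_iff, sub_eq_zero] at this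
  rw [key m m' hre, key n n' him]

theorem pairwiseDisjoint_latticeCell {ℓ : ℝ} (hℓ : 0 < ℓ) :
    (vortexLattice ℓ).PairwiseDisjoint (latticeCell ℓ) := by
  intro w hw w' hw' hne
  refine Set.disjoint_left.2 fun u hu hu' => hne ?_
  obtain ⟨⟨h1, h2⟩, h3, h4⟩ := mem_latticeCell.1 hu
  obtain ⟨⟨h1', h2'⟩, h3', h4'⟩ := mem_latticeCell.1 hu'
  refine eq_of_mem_vortexLattice_of_abs_lt hℓ hw hw' ?_ ?_ <;>
    (rw [abs_lt]; constructor <;> linarith)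

/-- The union of the cells of the lattice points. -/
def latticeRegion (ℓ : ℝ) : Set ℂ := ⋃ w ∈ vortexLattice ℓ, latticeCell ℓ w

theorem measurableSet_latticeRegion {ℓ : ℝ} (hℓ : 0 < ℓ) : MeasurableSet (latticeRegion ℓ) :=
  (vortexLattice_finite hℓ).measurableSet_biUnion fun w _ => measurableSet_latticeCell ℓ w

theorem two_lt_two_sqrt_two : 2 < 2 * √2 := by
  have : (1 : ℝ) < √2 := by
    rw [Real.lt_sqrt zero_le_one]
    norm_num
  linarith

theorem two_sqrt_two_lt_three : 2 * √2 < 3 := by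
  have : √2 < 3 / 2 := by
    rw [Real.sqrt_lt' (by norm_num)]
    norm_num
  linarith

theorem norm_le_of_mem_vortexLattice {ℓ : ℝ} (hℓ : 0 < ℓ) {w : ℂ} (hw : w ∈ vortexLattice ℓ) :
    ‖w‖ ≤ 1 - 2 * ℓ := by
  have := hw.2
  nlinarith [two_lt_two_sqrt_two]

theorem latticeRegion_subset_ball {ℓ : ℝ} (hℓ : 0 < ℓ) :
    latticeRegion ℓ ⊆ Metric.ball (0 : ℂ) 1 := by
  intro u hu
  simp only [latticeRegion, Set.mem_iUnion] at hu
  obtain ⟨w, hw, hu⟩ := hu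
  rw [mem_ball_zero_iff]
  have h1 := norm_le_of_mem_vortexLattice hℓ hw
  have h2 := norm_sub_le_of_mem_latticeCell hu
  have h3 := norm_add_le (u - w) w
  rw [sub_add_cancel] at h3
  linarith

/-- If `|u| ≤ 1 - 4ℓ`, rounding moves `u` by at most `ℓ` to a point of `ℓℤ²` of norm at most `1 -
3ℓ`, which is kept because `2√2 < 3`. -/
theorem ball_diff_latticeRegion_subset {ℓ : ℝ} (hℓ : 0 < ℓ) :
    Metric.ball (0 : ℂ) 1 \ latticeRegion ℓ
      ⊆ Metric.ball (0 : ℂ) 1 \ Metric.closedBall 0 (1 - 4 * ℓ) := by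
  refine Set.sdiff_subset_sdiff_right fun u hu => ?_
  rw [mem_closedBall_zero_iff] at hu
  set m : ℤ := ⌊u.re / ℓ + 1 / 2⌋ with hm
  set n : ℤ := ⌊u.im / ℓ + 1 / 2⌋ with hn
  have hround : ∀ (x : ℝ) (k : ℤ), k = ⌊x / ℓ + 1 / 2⌋ →
      (k * ℓ - ℓ / 2 ≤ x ∧ x < k * ℓ + ℓ / 2) := by
    rintro x k rfl
    have h1 := Int.floor_le (x / ℓ + 1 / 2)
    have h2 := Int.lt_floor_add_one (x / ℓ + 1 / 2)
    set k := ⌊x / ℓ + 1 / 2⌋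
    have h3 : x = x / ℓ * ℓ := by field_simp
    constructor <;> nlinarith
  have hu' : u ∈ latticeCell ℓ (⟨m * ℓ, n * ℓ⟩ : ℂ) :=
    mem_latticeCell.2 ⟨hround _ _ hm, hround _ _ hn⟩
  refine Set.mem_biUnion (x := (⟨m * ℓ, n * ℓ⟩ : ℂ)) ⟨⟨m, n, rfl⟩, ?_⟩ hu'
  have h2 := norm_sub_le_of_mem_latticeCell hu'
  have h3 := norm_sub_norm_le (⟨m * ℓ, n * ℓ⟩ : ℂ) u
  rw [norm_sub_rev] at h3
  nlinarith [two_sqrt_two_lt_three]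

theorem setIntegral_latticeRegion {E : Type*} [NormedAddCommGroup E] [NormedSpace ℝ E] {ℓ : ℝ}
    (hℓ : 0 < ℓ) {f : ℂ → E} (hf : IntegrableOn f (latticeRegion ℓ)) :
    ∫ u in latticeRegion ℓ, f u
      = ∑ w ∈ (vortexLattice_finite hℓ).toFinset, ∫ u in latticeCell ℓ w, f u := by
  have h1 : latticeRegion ℓ = ⋃ w ∈ (vortexLattice_finite hℓ).toFinset, latticeCell ℓ w := by
    simp [latticeRegion]
  rw [h1, integral_biUnion_finset _ (fun w _ => measurableSet_latticeCell ℓ w)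
    (by
      rw [Set.Finite.coe_toFinset]
      exact pairwiseDisjoint_latticeCell hℓ)]
  intro w hw
  refine hf.mono_set ?_
  exact Set.subset_biUnion_of_mem (u := latticeCell ℓ) (by simpa using hw)

/-- The cells are disjoint, have area `ℓ²` and lie in the unit disc. -/
theorem card_vortexLattice_mul_sq_le {ℓ : ℝ} (hℓ : 0 < ℓ) :
    ((vortexLattice_finite hℓ).toFinset.card : ℝ) * ℓ ^ 2 ≤ Real.pi := by
  have hb : volume.real (Metric.ball (0 : ℂ) 1) = Real.pi := by
    simp [Measure.real, Complex.volume_ball]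
  have hfin : volume (latticeRegion ℓ) ≠ ⊤ :=
    ((measure_mono (latticeRegion_subset_ball hℓ)).trans_lt measure_ball_lt_top).ne
  have h1 := setIntegral_latticeRegion hℓ (f := fun _ => (1 : ℝ)) (integrableOn_const hfin)
  simp_rw [setIntegral_const, volume_real_latticeCell hℓ.le] at h1
  simp only [smul_eq_mul, mul_one, Finset.sum_const, nsmul_eq_mul] at h1
  rw [← h1, ← hb]
  exact measureReal_mono (latticeRegion_subset_ball hℓ) measure_ball_lt_top.ne

/-! ### The neutralized field and its energy. -/

/-- The field of the vortices in a uniform neutralizing background. -/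
noncomputable def vortexField {ℓ : ℝ} (hℓ : 0 < ℓ) (z : ℂ) : ℂ :=
  ∑ w ∈ (vortexLattice_finite hℓ).toFinset, (z - w)⁻¹
    - ((Real.pi / ℓ ^ 2 : ℝ) : ℂ) * (starRingEnd ℂ) z

theorem measurable_vortexField {ℓ : ℝ} (hℓ : 0 < ℓ) : Measurable (vortexField hℓ) := by
  unfold vortexField
  refine Measurable.sub (Finset.measurable_fun_sum _ fun w _ => by fun_prop) ?_
  exact (Complex.continuous_conj.measurable).const_mul _

/-- The background `π conj z` is the Cauchy transform of the disc; its part on each cell screens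
that vortex, and the uncovered layer remains. -/
theorem vortexField_eq {ℓ : ℝ} (hℓ : 0 < ℓ) {z : ℂ} (hz : ‖z‖ < 1) :
    vortexField hℓ z = ∑ w ∈ (vortexLattice_finite hℓ).toFinset, cellField ℓ w z
      - ((ℓ : ℂ) ^ 2)⁻¹ * ∫ u in Metric.ball (0 : ℂ) 1 \ latticeRegion ℓ, (z - u)⁻¹ := by
  have hi := integrableOn_inv_sub z (Metric.isBounded_ball (x := (0 : ℂ)) (r := 1))
  have h1 := setIntegral_ball_inv_sub hz
  rw [← integral_inter_add_sdiff (measurableSet_latticeRegion hℓ) hi,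
    Set.inter_eq_right.2 (latticeRegion_subset_ball hℓ),
    setIntegral_latticeRegion hℓ (hi.mono_set (latticeRegion_subset_ball hℓ))] at h1
  simp only [cellField, Finset.sum_sub_distrib, ← Finset.mul_sum, vortexField]
  push_cast
  linear_combination (norm := ring) ((ℓ : ℂ) ^ 2)⁻¹ * h1

theorem norm_sum_cellField_sq_le :
    ∃ K : ℝ, 0 ≤ K ∧ ∀ (ℓ : ℝ) (hℓ : 0 < ℓ) (z : ℂ),
      ‖∑ w ∈ (vortexLattice_finite hℓ).toFinset, cellField ℓ w z‖ ^ 2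
        ≤ 2 * ∑ w ∈ (vortexLattice_finite hℓ).toFinset,
            (if ‖z - w‖ < ℓ / 2 then (‖z - w‖ ^ 2)⁻¹ else 0) + K / ℓ ^ 2 := by
  obtain ⟨K, hK0, hK⟩ := exists_integral_add_norm_sub_rpow
  refine ⟨2 * (10000 * K) ^ 2, by positivity, fun ℓ hℓ z => ?_⟩
  set s := (vortexLattice_finite hℓ).toFinset with hs
  obtain ⟨hKi, hKv⟩ := hK ℓ z hℓ
  have h1 : ∑ w ∈ s, ∫ u in latticeCell ℓ w, ((ℓ + ‖z - u‖) ^ 3)⁻¹ ≤ K / ℓ := by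
    rw [← setIntegral_latticeRegion hℓ hKi.integrableOn, ← hKv]
    exact setIntegral_le_integral hKi (Filter.Eventually.of_forall fun u => by positivity)
  have h2 : ‖∑ w ∈ s, cellField ℓ w z‖
      ≤ ∑ w ∈ s, (if ‖z - w‖ < ℓ / 2 then ‖z - w‖⁻¹ else 0) + 10000 * (K / ℓ) := by
    refine (norm_sum_le _ _).trans
      ((Finset.sum_le_sum fun w _ => norm_cellField_le_add_integral hℓ w z).trans ?_)
    rw [Finset.sum_add_distrib, ← Finset.mul_sum]
    gcongr
  have h3 : (∑ w ∈ s, (if ‖z - w‖ < ℓ / 2 then ‖z - w‖⁻¹ else 0)) ^ 2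
      ≤ ∑ w ∈ s, (if ‖z - w‖ < ℓ / 2 then (‖z - w‖ ^ 2)⁻¹ else 0) := by
    rw [← Finset.sum_filter, ← Finset.sum_filter]
    refine sq_sum_le_card_mul_sum_sq.trans ?_
    -- Two lattice points within `ℓ / 2` of `z` would be less than `ℓ` apart. So at most one term is
    -- nonzero, and the square of the sum costs no factor.
    have hcard : (s.filter fun w => ‖z - w‖ < ℓ / 2).card ≤ 1 := by
      refine Finset.card_le_one.2 fun w hw w' hw' => ?_
      simp only [hs, Finset.mem_filter, Set.Finite.mem_toFinset] at hw hw'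
      have h4 : ‖w - w'‖ < ℓ := by
        have := norm_sub_le (z - w') (z - w)
        rw [sub_sub_sub_cancel_left] at this
        linarith [hw.2, hw'.2]
      exact eq_of_mem_vortexLattice_of_abs_lt hℓ hw.1 hw'.1
        ((Complex.abs_re_le_norm (w - w')).trans_lt h4)
        ((Complex.abs_im_le_norm (w - w')).trans_lt h4)
    have hcard' : ((s.filter fun w => ‖z - w‖ < ℓ / 2).card : ℝ) ≤ 1 := by exact_mod_cast hcard
    simp only [inv_pow]
    exact mul_le_of_le_one_left (Finset.sum_nonneg fun w _ => by positivity) hcard'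
  have h5 := pow_le_pow_left₀ (norm_nonneg _) h2 2
  have h6 : 2 * (10000 * K) ^ 2 / ℓ ^ 2 = 2 * (10000 * (K / ℓ)) ^ 2 := by ring
  rw [h6]
  refine h5.trans (add_sq_le.trans ?_)
  linarith

theorem measurableSet_perforatedDisc {ℓ : ℝ} (hℓ : 0 < ℓ) (a : ℝ) :
    MeasurableSet (perforatedDisc ℓ a) :=
  measurableSet_ball.diff
    ((vortexLattice_finite hℓ).measurableSet_biUnion fun _ _ => measurableSet_ball)

theorem perforatedDisc_subset_ball (ℓ a : ℝ) : perforatedDisc ℓ a ⊆ Metric.ball (0 : ℂ) 1 :=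
  Set.sdiff_subset

theorem volume_perforatedDisc_lt_top (ℓ a : ℝ) : volume (perforatedDisc ℓ a) < ⊤ :=
  (measure_mono (perforatedDisc_subset_ball ℓ a)).trans_lt measure_ball_lt_top

theorem le_norm_sub_of_mem_perforatedDisc {ℓ a : ℝ} {w z : ℂ} (hw : w ∈ vortexLattice ℓ)
    (hz : z ∈ perforatedDisc ℓ a) : a ≤ ‖z - w‖ := by
  by_contra h
  rw [not_le, ← dist_eq_norm, ← Metric.mem_ball] at h
  exact hz.2 (Set.mem_biUnion hw h)

/-- A crude bound, serving only the integrability of `|f|²` on the perforated disc. -/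
theorem norm_vortexField_le_of_mem_perforatedDisc {ℓ a : ℝ} (hℓ : 0 < ℓ) (ha : 0 < a) {z : ℂ}
    (hz : z ∈ perforatedDisc ℓ a) :
    ‖vortexField hℓ z‖
      ≤ (vortexLattice_finite hℓ).toFinset.card * a⁻¹ + Real.pi / ℓ ^ 2 := by
  have hz1 : ‖z‖ < 1 := mem_ball_zero_iff.1 (perforatedDisc_subset_ball ℓ a hz)
  refine (norm_sub_le _ _).trans (add_le_add ?_ ?_)
  · rw [← nsmul_eq_mul]
    refine (norm_sum_le _ _).trans (Finset.sum_le_card_nsmul _ _ _ fun w hw => ?_)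
    rw [norm_inv]
    have := le_norm_sub_of_mem_perforatedDisc (by simpa using hw) hz
    gcongr
  · have hp : 0 ≤ Real.pi / ℓ ^ 2 := by positivity
    rw [norm_mul, Complex.norm_real, Real.norm_of_nonneg hp, Complex.norm_conj]
    exact mul_le_of_le_one_right hp hz1.le

theorem setIntegral_perforatedDisc_near_le {ℓ a : ℝ} (ha : 0 < a) (haℓ : a ≤ ℓ / 2)
    {w : ℂ} (hw : w ∈ vortexLattice ℓ) :
    IntegrableOn (fun z : ℂ => if ‖z - w‖ < ℓ / 2 then (‖z - w‖ ^ 2)⁻¹ else 0)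
        (perforatedDisc ℓ a) ∧
      ∫ z in perforatedDisc ℓ a, (if ‖z - w‖ < ℓ / 2 then (‖z - w‖ ^ 2)⁻¹ else 0)
        ≤ 2 * Real.pi * Real.log (ℓ / (2 * a)) := by
  have hif : (fun z : ℂ => if ‖z - w‖ < ℓ / 2 then (‖z - w‖ ^ 2)⁻¹ else 0)
      = (Metric.ball w (ℓ / 2)).indicator fun z => (‖w - z‖ ^ 2)⁻¹ := by
    funext z
    simp only [Set.indicator, mem_ball_iff_norm, norm_sub_rev w z]
  have hann : IntegrableOn (fun z : ℂ => (‖w - z‖ ^ 2)⁻¹)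
      (Metric.ball w (ℓ / 2) \ Metric.ball w a) := by
    refine Measure.integrableOn_of_bounded (M := (a ^ 2)⁻¹)
      ((measure_mono Set.sdiff_subset).trans_lt measure_ball_lt_top).ne
      (Measurable.aestronglyMeasurable (by fun_prop)) ?_
    refine (ae_restrict_iff' (measurableSet_ball.diff measurableSet_ball)).2
      (Filter.Eventually.of_forall fun z hz => ?_)
    have h1 : a ≤ ‖w - z‖ := by
      have := hz.2
      rwa [mem_ball_iff_norm', not_lt] at this
    rw [Real.norm_of_nonneg (by positivity)]
    gcongr
  have hsub : perforatedDisc ℓ a ∩ Metric.ball w (ℓ / 2)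
      ⊆ Metric.ball w (ℓ / 2) \ Metric.ball w a := by
    refine fun z hz => ⟨hz.2, ?_⟩
    rw [mem_ball_iff_norm, not_lt]
    exact le_norm_sub_of_mem_perforatedDisc hw hz.1
  rw [hif]
  constructor
  · rw [IntegrableOn, integrable_indicator_iff measurableSet_ball, IntegrableOn,
      Measure.restrict_restrict measurableSet_ball, Set.inter_comm]
    exact hann.mono_set hsub
  · rw [setIntegral_indicator measurableSet_ball]
    refine (setIntegral_mono_set hann (Filter.Eventually.of_forall fun z => by positivity)
      (Filter.Eventually.of_forall hsub)).trans_eq ?_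
    rw [setIntegral_annulus_inv_norm_sub_sq w ha haℓ, div_div]

open ENNReal in
theorem exists_setIntegral_vortexField_sq_le :
    ∃ K : ℝ, 0 ≤ K ∧ ∀ (ℓ : ℝ) (hℓ : 0 < ℓ) (a : ℝ), ℓ ≤ 1 / 8 → 0 < a → a ≤ ℓ / 2 →
      ∫ z in perforatedDisc ℓ a, ‖vortexField hℓ z‖ ^ 2
        ≤ K / ℓ ^ 2 * (1 + Real.log (ℓ / (2 * a))) := by
  obtain ⟨K₁, hK₁, h1⟩ := norm_sum_cellField_sq_le
  obtain ⟨K₂, hK₂, h2⟩ := exists_lintegral_sq_lintegral_annulus_le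
  refine ⟨2 * K₁ * Real.pi + 32 * K₂ + 8 * Real.pi ^ 2, by positivity,
    fun ℓ hℓ a hℓ8 ha haℓ => ?_⟩
  set s := (vortexLattice_finite hℓ).toFinset with hs
  set S := Metric.ball (0 : ℂ) 1 \ latticeRegion ℓ with hS
  set Λ := perforatedDisc ℓ a with hΛ
  have hlog : 0 ≤ Real.log (ℓ / (2 * a)) := by
    refine Real.log_nonneg ?_
    rw [le_div_iff₀ (by positivity)]
    linarith
  set near : ℂ → ℂ → ℝ := fun w z => if ‖z - w‖ < ℓ / 2 then (‖z - w‖ ^ 2)⁻¹ else 0 with hnear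
  have hnear0 : ∀ w z, 0 ≤ near w z := fun w z => by
    simp only [hnear]
    split_ifs <;> positivity
  -- Twice the bound of `norm_sum_cellField_sq_le`; the factor 2 comes from separating the cells
  -- from the layer in the square.
  set g : ℂ → ℝ := fun z => 4 * ∑ w ∈ s, near w z + 2 * (K₁ / ℓ ^ 2) with hg
  have hg0 : ∀ z, 0 ≤ g z := fun z => by
    have := Finset.sum_nonneg fun w (_ : w ∈ s) => hnear0 w z
    simp only [hg]
    positivity
  have hmem : ∀ w ∈ s, w ∈ vortexLattice ℓ := fun w hw => by simpa [hs] using hw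
  have hsumint : IntegrableOn (fun z => ∑ w ∈ s, near w z) Λ :=
    integrable_finsetSum _ fun w hw =>
      (setIntegral_perforatedDisc_near_le ha haℓ (hmem w hw)).1
  have hcint : IntegrableOn (fun _ : ℂ => 2 * (K₁ / ℓ ^ 2)) Λ :=
    integrableOn_const (volume_perforatedDisc_lt_top ℓ a).ne
  have hgint : IntegrableOn g Λ := (hsumint.const_mul 4).add hcint
  have hN := card_vortexLattice_mul_sq_le hℓ
  rw [← hs] at hN
  have hgval : ∫ z in Λ, g z
      ≤ (2 * K₁ * Real.pi + 8 * Real.pi ^ 2 * Real.log (ℓ / (2 * a))) / ℓ ^ 2 := by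
    have hvol : volume.real Λ ≤ Real.pi := by
      have hb : volume.real (Metric.ball (0 : ℂ) 1) = Real.pi := by
        simp [Measure.real, Complex.volume_ball]
      rw [← hb]
      exact measureReal_mono (perforatedDisc_subset_ball ℓ a) measure_ball_lt_top.ne
    rw [hg, integral_add (hsumint.const_mul 4) hcint, integral_const_mul, setIntegral_const,
      integral_finsetSum _ fun w hw =>
        (setIntegral_perforatedDisc_near_le ha haℓ (hmem w hw)).1]
    have h3 : ∑ w ∈ s, ∫ z in Λ, near w z
        ≤ s.card * (2 * Real.pi * Real.log (ℓ / (2 * a))) := by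
      rw [← nsmul_eq_mul]
      exact Finset.sum_le_card_nsmul _ _ _ fun w hw =>
        (setIntegral_perforatedDisc_near_le ha haℓ (hmem w hw)).2
    have h4 : (s.card : ℝ) ≤ Real.pi / ℓ ^ 2 := by
      rw [le_div_iff₀ (by positivity)]
      exact hN
    have h5 : (s.card : ℝ) * (2 * Real.pi * Real.log (ℓ / (2 * a)))
        ≤ Real.pi / ℓ ^ 2 * (2 * Real.pi * Real.log (ℓ / (2 * a))) := by gcongr
    have h6 : volume.real Λ • (2 * (K₁ / ℓ ^ 2)) ≤ Real.pi * (2 * (K₁ / ℓ ^ 2)) := by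
      rw [smul_eq_mul]
      gcongr
    calc _ ≤ 4 * (Real.pi / ℓ ^ 2 * (2 * Real.pi * Real.log (ℓ / (2 * a))))
          + Real.pi * (2 * (K₁ / ℓ ^ 2)) := by linarith
      _ = _ := by ring
  have hpt : ∀ z ∈ Λ, ENNReal.ofReal (‖vortexField hℓ z‖ ^ 2)
      ≤ ENNReal.ofReal (g z) + ENNReal.ofReal (2 / ℓ ^ 4) * (∫⁻ u in S, ‖z - u‖ₑ⁻¹) ^ 2 := by
    intro z hz
    have hz1 : ‖z‖ < 1 := mem_ball_zero_iff.1 (perforatedDisc_subset_ball ℓ a hz)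
    set F := ∫ u in S, (z - u)⁻¹ with hF
    have h3 : ‖vortexField hℓ z‖ ^ 2 ≤ g z + 2 / ℓ ^ 4 * ‖F‖ ^ 2 := by
      rw [vortexField_eq hℓ hz1, ← hF, ← hs]
      have h4 := h1 ℓ hℓ z
      rw [← hs] at h4
      have h5 := pow_le_pow_left₀ (norm_nonneg _)
        (norm_sub_le (∑ w ∈ s, cellField ℓ w z) (((ℓ : ℂ) ^ 2)⁻¹ * F)) 2
      have h6 : 2 / ℓ ^ 4 * ‖F‖ ^ 2 = 2 * ‖((ℓ : ℂ) ^ 2)⁻¹ * F‖ ^ 2 := by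
        rw [norm_mul, norm_inv, norm_pow, Complex.norm_real, Real.norm_of_nonneg hℓ.le]
        field_simp
      rw [h6]
      refine h5.trans (add_sq_le.trans ?_)
      simp only [hg]
      linarith
    refine (ENNReal.ofReal_le_ofReal h3).trans ?_
    rw [ENNReal.ofReal_add (hg0 z) (by positivity), ENNReal.ofReal_mul (by positivity),
      ENNReal.ofReal_pow (norm_nonneg _), ofReal_norm]
    gcongr
    refine (enorm_integral_le_lintegral_enorm _).trans (lintegral_mono fun u => ?_)
    by_cases hu : z - u = 0
    · simp [hu]
    · rw [enorm_inv hu]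
  have hSm : MeasurableSet S := measurableSet_ball.diff (measurableSet_latticeRegion hℓ)
  have h3 := h2 S (4 * ℓ) (by positivity) (by linarith) hSm (ball_diff_latticeRegion_subset hℓ)
  have hgm : Measurable g := by
    refine Measurable.add_const (Measurable.const_mul (Finset.measurable_fun_sum _ fun w _ => ?_) _) _
    exact Measurable.ite (measurableSet_lt (by fun_prop) measurable_const) (by fun_prop)
      measurable_const
  have hΛm := measurableSet_perforatedDisc hℓ a
  have hgi0 : 0 ≤ ∫ z in Λ, g z := integral_nonneg hg0
  -- With `∫⁻` no integrability of the squared layer field is needed. The layer has width `t = 4 ℓ`,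
  -- and `ℓ ≤ 1 / 8` ensures `t ≤ 1 / 2`.
  have hlin : ∫⁻ z in Λ, ENNReal.ofReal (‖vortexField hℓ z‖ ^ 2)
      ≤ ENNReal.ofReal ((∫ z in Λ, g z) + 2 / ℓ ^ 4 * (K₂ * (4 * ℓ) ^ 2)) := by
    refine (setLIntegral_mono' hΛm hpt).trans ?_
    rw [lintegral_add_left hgm.ennreal_ofReal, lintegral_const_mul' _ _ ENNReal.ofReal_ne_top,
      ENNReal.ofReal_add hgi0 (by positivity), ENNReal.ofReal_mul (by positivity),
      ofReal_integral_eq_lintegral_ofReal hgint (Filter.Eventually.of_forall hg0)]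
    gcongr
    exact (lintegral_mono_set (perforatedDisc_subset_ball ℓ a)).trans h3
  rw [integral_eq_lintegral_of_nonneg_ae (Filter.Eventually.of_forall fun z => by positivity)
    ((measurable_vortexField hℓ).norm.pow_const 2).aestronglyMeasurable]
  refine (ENNReal.toReal_le_of_le_ofReal (by positivity) hlin).trans ?_
  have h4 : 2 / ℓ ^ 4 * (K₂ * (4 * ℓ) ^ 2) = 32 * K₂ / ℓ ^ 2 := by
    field_simp
    ring
  rw [h4]
  refine (add_le_add_left hgval _).trans ?_
  rw [← add_div, div_mul_eq_mul_div]
  gcongr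
  nlinarith [mul_nonneg hK₁ Real.pi_pos.le, mul_nonneg (mul_nonneg hK₁ Real.pi_pos.le) hlog,
    mul_nonneg hK₂ hlog, sq_nonneg Real.pi, hlog]

/-! ### The first moment of the neutralized field and the effect of the holes. -/

/-- Midpoint rule: the linear term vanishes by symmetry of the cell, and the error is `∫ |u - w|² ≤
ℓ² · ℓ²`. -/
theorem setIntegral_latticeCell_one_sub_norm_sq {ℓ : ℝ} (hℓ : 0 ≤ ℓ) (w : ℂ) :
    |ℓ ^ 2 * (1 - ‖w‖ ^ 2) - ∫ u in latticeCell ℓ w, (1 - ‖u‖ ^ 2)| ≤ ℓ ^ 4 := by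
  have hfin : volume (latticeCell ℓ w) ≠ ⊤ := (isBounded_latticeCell ℓ w).measure_lt_top.ne
  have hcont : ∀ f : ℂ → ℝ, Continuous f → IntegrableOn f (latticeCell ℓ w) := fun f hf =>
    (hf.continuousOn.integrableOn_compact (isCompact_closedBall w ℓ)).mono_set fun u hu => by
      simpa [dist_eq_norm] using norm_sub_le_of_mem_latticeCell hu
  have hpt : ∀ u : ℂ, (1 - ‖w‖ ^ 2) - (1 - ‖u‖ ^ 2)
      = ((2 * (starRingEnd ℂ) w) * (u - w)).re + ‖u - w‖ ^ 2 := by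
    intro u
    simp only [← Complex.normSq_eq_norm_sq, Complex.normSq_apply]
    simp
    ring
  have h1 : ℓ ^ 2 * (1 - ‖w‖ ^ 2) = ∫ u in latticeCell ℓ w, (1 - ‖w‖ ^ 2) := by
    rw [setIntegral_const, volume_real_latticeCell hℓ, smul_eq_mul]
  have h2 : ∫ u in latticeCell ℓ w, ((2 * (starRingEnd ℂ) w) * (u - w)).re = 0 := by
    have hi : IntegrableOn (fun u : ℂ => (2 * (starRingEnd ℂ) w) * (u - w)) (latticeCell ℓ w) :=
      integrableOn_latticeCell (by fun_prop) ℓ w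
    have h3 := Complex.reCLM.integral_comp_comm hi
    simp only [Complex.reCLM_apply] at h3
    rw [h3, integral_const_mul, setIntegral_latticeCell_sub_center hℓ]
    simp
  rw [h1, ← integral_sub (hcont _ (by fun_prop)) (hcont _ (by fun_prop))]
  simp_rw [hpt]
  rw [integral_add (hcont _ (by fun_prop)) (hcont _ (by fun_prop)), h2, zero_add]
  have h4 : ‖∫ u in latticeCell ℓ w, ‖u - w‖ ^ 2‖ ≤ ℓ ^ 2 * volume.real (latticeCell ℓ w) := by
    refine norm_setIntegral_le_of_norm_le_const hfin.lt_top fun u hu => ?_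
    rw [Real.norm_of_nonneg (by positivity)]
    have := norm_sub_le_of_mem_latticeCell hu
    gcongr
  rw [volume_real_latticeCell hℓ] at h4
  exact h4.trans_eq (by ring)

theorem volume_real_ball_complex : volume.real (Metric.ball (0 : ℂ) 1) = Real.pi := by
  simp [Measure.real, Complex.volume_ball]

theorem integrableOn_ball_of_continuous {E : Type*} [NormedAddCommGroup E] {f : ℂ → E}
    (hf : Continuous f) : IntegrableOn f (Metric.ball (0 : ℂ) 1) :=
  (hf.continuousOn.integrableOn_compact (isCompact_closedBall 0 1)).mono_set
    Metric.ball_subset_closedBall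

/-- The integrand is at most `2t` near the unit circle and the area at most `2πt`. This vanishing at
the boundary makes the layer cost only `O(ℓ²)` in the first moment. -/
theorem setIntegral_annulus_one_sub_norm_sq_le {t : ℝ} (ht : 0 < t) (ht2 : t ≤ 1) {S : Set ℂ}
    (hSt : S ⊆ Metric.ball (0 : ℂ) 1 \ Metric.closedBall 0 (1 - t)) :
    |∫ u in S, (1 - ‖u‖ ^ 2)| ≤ 4 * Real.pi * t ^ 2 := by
  have hvol : volume.real S ≤ 2 * Real.pi * t := by
    refine (measureReal_mono hSt
      ((measure_mono Set.sdiff_subset).trans_lt measure_ball_lt_top).ne).trans ?_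
    have h0 : Metric.closedBall (0 : ℂ) (1 - t) ⊆ Metric.ball 0 1 :=
      Metric.closedBall_subset_ball (by linarith)
    rw [measureReal_sdiff h0 measurableSet_closedBall, volume_real_ball_complex]
    have h1 : volume.real (Metric.closedBall (0 : ℂ) (1 - t)) = (1 - t) ^ 2 * Real.pi := by
      simp [Measure.real, Complex.volume_closedBall, ENNReal.toReal_ofReal (sub_nonneg.2 ht2)]
    rw [h1]
    nlinarith [mul_pos Real.pi_pos (mul_pos ht ht)]
  have hfin : volume S < ⊤ :=
    (measure_mono (hSt.trans Set.sdiff_subset)).trans_lt measure_ball_lt_top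
  have h1 : ‖∫ u in S, (1 - ‖u‖ ^ 2)‖ ≤ 2 * t * volume.real S := by
    refine norm_setIntegral_le_of_norm_le_const hfin fun u hu => ?_
    obtain ⟨h2, h3⟩ := hSt hu
    rw [mem_ball_zero_iff] at h2
    rw [mem_closedBall_zero_iff, not_le] at h3
    have h4 := norm_nonneg u
    rw [Real.norm_eq_abs, abs_le]
    constructor <;> nlinarith
  refine (Real.norm_eq_abs _).symm.trans_le (h1.trans ?_)
  calc 2 * t * volume.real S ≤ 2 * t * (2 * Real.pi * t) := by gcongr
    _ = _ := by ring

theorem integrableOn_ball_mul_vortexField {ℓ : ℝ} (hℓ : 0 < ℓ) :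
    IntegrableOn (fun z => z * vortexField hℓ z) (Metric.ball (0 : ℂ) 1) ∧
    IntegrableOn (vortexField hℓ) (Metric.ball (0 : ℂ) 1) := by
  have h1 : IntegrableOn (vortexField hℓ) (Metric.ball (0 : ℂ) 1) := by
    refine Integrable.sub (integrable_finsetSum _ fun w _ =>
      integrableOn_inv_sub' w Metric.isBounded_ball) ?_
    exact integrableOn_ball_of_continuous (by fun_prop)
  refine ⟨?_, h1⟩
  refine h1.bdd_mul (c := 1) (by fun_prop) ?_
  refine (ae_restrict_iff' measurableSet_ball).2 (Filter.Eventually.of_forall fun z hz => ?_)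
  exact (mem_ball_zero_iff.1 hz).le

/-- The first moment of the neutralized vortex field is bounded. -/
theorem norm_setIntegral_ball_mul_vortexField_le {ℓ : ℝ} (hℓ : 0 < ℓ) (hℓ8 : ℓ ≤ 1 / 8) :
    ‖∫ z in Metric.ball (0 : ℂ) 1, z * vortexField hℓ z‖ ≤ 65 * Real.pi ^ 2 := by
  set s := (vortexLattice_finite hℓ).toFinset with hs
  have hmem : ∀ w ∈ s, ‖w‖ < 1 := fun w hw => by
    have := norm_le_of_mem_vortexLattice hℓ (w := w) (by simpa [hs] using hw)
    linarith
  have hone : IntegrableOn (fun u : ℂ => 1 - ‖u‖ ^ 2) (Metric.ball (0 : ℂ) 1) :=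
    integrableOn_ball_of_continuous (by fun_prop)
  have hhalf : ∫ u in Metric.ball (0 : ℂ) 1, (1 - ‖u‖ ^ 2) = Real.pi / 2 := by
    rw [integral_sub (integrableOn_ball_of_continuous (by fun_prop))
      (integrableOn_ball_of_continuous (by fun_prop)), setIntegral_ball_norm_sq, setIntegral_const,
      volume_real_ball_complex, smul_eq_mul]
    ring
  have hval : ∫ z in Metric.ball (0 : ℂ) 1, z * vortexField hℓ z
      = ((Real.pi * (∑ w ∈ s, (1 - ‖w‖ ^ 2) - (Real.pi / 2) / ℓ ^ 2) : ℝ) : ℂ) := by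
    have hexp : ∀ z : ℂ, z * vortexField hℓ z = ∑ w ∈ s, z * (z - w)⁻¹
        - ((Real.pi / ℓ ^ 2 : ℝ) : ℂ) * ((‖z‖ ^ 2 : ℝ) : ℂ) := by
      intro z
      rw [vortexField, mul_sub, Finset.mul_sum, mul_left_comm, Complex.mul_conj']
      push_cast
      rfl
    have hi : ∀ w ∈ s, Integrable (fun z : ℂ => z * (z - w)⁻¹)
        (volume.restrict (Metric.ball (0 : ℂ) 1)) := fun w _ => by
      refine Integrable.bdd_mul (c := 1) (integrableOn_inv_sub' w Metric.isBounded_ball)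
        (by fun_prop) ?_
      refine (ae_restrict_iff' measurableSet_ball).2 (Filter.Eventually.of_forall fun z hz => ?_)
      exact (mem_ball_zero_iff.1 hz).le
    simp_rw [hexp]
    rw [integral_sub (integrable_finsetSum _ hi)
      (integrableOn_ball_of_continuous (by fun_prop)), integral_finsetSum _ hi,
      Finset.sum_congr rfl fun w hw => setIntegral_ball_mul_inv_sub (hmem w hw),
      integral_const_mul, integral_complex_ofReal, setIntegral_ball_norm_sq, ← Finset.mul_sum]
    push_cast
    ring
  have hsum : |ℓ ^ 2 * ∑ w ∈ s, (1 - ‖w‖ ^ 2) - ∫ u in latticeRegion ℓ, (1 - ‖u‖ ^ 2)|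
      ≤ s.card * ℓ ^ 4 := by
    rw [setIntegral_latticeRegion hℓ (hone.mono_set (latticeRegion_subset_ball hℓ)),
      Finset.mul_sum, ← Finset.sum_sub_distrib]
    refine (Finset.abs_sum_le_sum_abs _ _).trans ?_
    rw [← nsmul_eq_mul]
    exact Finset.sum_le_card_nsmul _ _ _ fun w _ => setIntegral_latticeCell_one_sub_norm_sq hℓ.le w
  have hann := setIntegral_annulus_one_sub_norm_sq_le (t := 4 * ℓ) (by positivity) (by linarith)
    (ball_diff_latticeRegion_subset hℓ)
  have hsplit := integral_inter_add_sdiff (measurableSet_latticeRegion hℓ) hone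
  rw [Set.inter_eq_right.2 (latticeRegion_subset_ball hℓ), hhalf] at hsplit
  have hN := card_vortexLattice_mul_sq_le hℓ
  rw [← hs] at hN
  have hN4 : s.card * ℓ ^ 4 ≤ Real.pi * ℓ ^ 2 := by
    calc (s.card : ℝ) * ℓ ^ 4 = s.card * ℓ ^ 2 * ℓ ^ 2 := by ring
      _ ≤ _ := by gcongr
  -- The midpoint errors give `π ℓ²` and the layer `4π (4ℓ)² = 64 π ℓ²`.
  have hmain : |ℓ ^ 2 * ∑ w ∈ s, (1 - ‖w‖ ^ 2) - Real.pi / 2| ≤ 65 * Real.pi * ℓ ^ 2 := by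
    rw [← hsplit]
    rw [abs_le] at *
    constructor <;> linarith [hsum.1, hsum.2, hann.1, hann.2]
  rw [hval, Complex.norm_real, Real.norm_eq_abs, abs_mul, abs_of_pos Real.pi_pos]
  have h5 : ∑ w ∈ s, (1 - ‖w‖ ^ 2) - (Real.pi / 2) / ℓ ^ 2
      = (ℓ ^ 2 * ∑ w ∈ s, (1 - ‖w‖ ^ 2) - Real.pi / 2) / ℓ ^ 2 := by
    field_simp
  rw [h5, abs_div, abs_of_pos (by positivity : 0 < ℓ ^ 2)]
  calc _ ≤ Real.pi * (65 * Real.pi * ℓ ^ 2 / ℓ ^ 2) := by gcongr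
    _ = _ := by field_simp

/-- The removed balls contribute little to the `L¹` norm of the neutralized vortex field. -/
theorem setIntegral_holes_norm_vortexField_le {ℓ a : ℝ} (hℓ : 0 < ℓ) (ha : 0 < a) (ha1 : a ≤ 1) :
    ∫ z in Metric.ball (0 : ℂ) 1 \ perforatedDisc ℓ a, ‖vortexField hℓ z‖
      ≤ 2 * Real.pi ^ 3 * a / ℓ ^ 4 + 2 * Real.pi ^ 2 * a / ℓ ^ 2 := by
  set s := (vortexLattice_finite hℓ).toFinset with hs
  set T := Metric.ball (0 : ℂ) 1 \ perforatedDisc ℓ a with hT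
  have hTm : MeasurableSet T := measurableSet_ball.diff (measurableSet_perforatedDisc hℓ a)
  have hTb : T ⊆ Metric.ball (0 : ℂ) 1 := Set.sdiff_subset
  have hTbd : Bornology.IsBounded T := Metric.isBounded_ball.subset hTb
  have hN := card_vortexLattice_mul_sq_le hℓ
  rw [← hs] at hN
  have hvolT : volume.real T ≤ s.card * (Real.pi * a ^ 2) := by
    have hsub : T ⊆ ⋃ w ∈ s, Metric.ball w a := by
      intro z hz
      by_contra h
      refine hz.2 ⟨hz.1, ?_⟩
      simpa [hs] using h
    refine (measureReal_mono hsub ?_).trans ((measureReal_biUnion_finset_le _ _).trans ?_)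
    · exact (measure_biUnion_lt_top s.finite_toSet fun _ _ => measure_ball_lt_top).ne
    · rw [← nsmul_eq_mul]
      refine Finset.sum_le_card_nsmul _ _ _ fun w _ => le_of_eq ?_
      simp [Measure.real, Complex.volume_ball, ENNReal.toReal_ofReal ha.le, mul_comm]
  have hN' : (s.card : ℝ) ≤ Real.pi / ℓ ^ 2 := by
    rw [le_div_iff₀ (by positivity)]
    exact hN
  have hpi := Real.pi_pos
  have hvolT' : volume.real T ≤ Real.pi / ℓ ^ 2 * (Real.pi * a ^ 2) := hvolT.trans (by gcongr)
  -- The cut-off radius `ρ = a` balances the area of the holes, of order `a² / ℓ²`, against the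
  -- pole.
  have hpole : ∀ w ∈ s, ∫ z in T, ‖z - w‖⁻¹ ≤ Real.pi / ℓ ^ 2 * (Real.pi * a) + 2 * Real.pi * a := by
    intro w _
    simp_rw [norm_sub_rev _ w]
    refine (setIntegral_inv_norm_sub_le w hTbd hTm ha).trans ?_
    gcongr
    rw [div_le_iff₀ ha]
    exact hvolT'.trans_eq (by ring)
  have hi : ∀ w ∈ s, Integrable (fun z : ℂ => ‖z - w‖⁻¹) (volume.restrict T) := fun w _ => by
    simp_rw [norm_sub_rev _ w]
    exact integrableOn_inv_norm_sub w hTbd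
  have hcT : Integrable (fun _ : ℂ => Real.pi / ℓ ^ 2) (volume.restrict T) :=
    integrableOn_const hTbd.measure_lt_top.ne
  have hbound : ∫ z in T, ‖vortexField hℓ z‖
      ≤ ∫ z in T, (∑ w ∈ s, ‖z - w‖⁻¹ + Real.pi / ℓ ^ 2) := by
    refine setIntegral_mono_on ((integrableOn_ball_mul_vortexField hℓ).2.mono_set hTb).norm
      ((integrable_finsetSum _ hi).add hcT) hTm fun z hz => ?_
    have hz1 : ‖z‖ < 1 := mem_ball_zero_iff.1 (hTb hz)
    refine (norm_sub_le _ _).trans (add_le_add ?_ ?_)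
    · simpa only [norm_inv] using norm_sum_le s fun w => (z - w)⁻¹
    · have hp : 0 ≤ Real.pi / ℓ ^ 2 := by positivity
      rw [norm_mul, Complex.norm_real, Real.norm_of_nonneg hp, Complex.norm_conj]
      exact mul_le_of_le_one_right hp hz1.le
  refine hbound.trans ?_
  rw [integral_add (integrable_finsetSum _ hi) hcT, integral_finsetSum _ hi, setIntegral_const,
    smul_eq_mul]
  have hsum : ∑ w ∈ s, ∫ z in T, ‖z - w‖⁻¹
      ≤ Real.pi / ℓ ^ 2 * (Real.pi / ℓ ^ 2 * (Real.pi * a) + 2 * Real.pi * a) := by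
    refine (Finset.sum_le_card_nsmul _ _ _ hpole).trans ?_
    rw [nsmul_eq_mul]
    gcongr
  have hrest : volume.real T * (Real.pi / ℓ ^ 2)
      ≤ Real.pi / ℓ ^ 2 * (Real.pi * a) * (Real.pi / ℓ ^ 2) := by
    gcongr
    refine hvolT'.trans ?_
    gcongr
    nlinarith
  calc _ ≤ _ := add_le_add hsum hrest
    _ = 2 * Real.pi ^ 3 * a / ℓ ^ 4 + 2 * Real.pi ^ 2 * a / ℓ ^ 2 := by
      field_simp
      ring

/-! ### Assembly of the three terms and choice of the constants. -/

theorem magneticDensity_vortexPhase_eq (Ω : ℝ) {ℓ : ℝ} (hℓ : 0 < ℓ) {z : ℂ}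
    (h : z ∉ vortexLattice ℓ) :
    magneticDensity Ω (vortexPhase ℓ) z = ‖vortexField hℓ z‖ ^ 2
      + 2 * (Real.pi / ℓ ^ 2 - Ω / 2) * (z * vortexField hℓ z).re
      + (Real.pi / ℓ ^ 2 - Ω / 2) ^ 2 * ‖z‖ ^ 2 := by
  have h1 : ∑ w ∈ (vortexLattice_finite hℓ).toFinset, (z - w)⁻¹
      - (Ω / 2 : ℝ) * (starRingEnd ℂ) z
      = vortexField hℓ z + ((Real.pi / ℓ ^ 2 - Ω / 2 : ℝ) : ℂ) * (starRingEnd ℂ) z := by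
    rw [vortexField]
    push_cast
    ring
  rw [magneticDensity_vortexPhase Ω hℓ h, h1]
  generalize vortexField hℓ z = f
  generalize Real.pi / ℓ ^ 2 - Ω / 2 = c
  simp only [← Complex.normSq_eq_norm_sq, Complex.normSq_apply, Complex.add_re, Complex.add_im,
    Complex.mul_re, Complex.mul_im, Complex.ofReal_re, Complex.ofReal_im, Complex.conj_re,
    Complex.conj_im]
  ring

theorem setIntegral_magneticDensity_vortexPhase_le (Ω : ℝ) {ℓ a : ℝ} (hℓ : 0 < ℓ)
    (hℓ8 : ℓ ≤ 1 / 8) (ha : 0 < a) (ha1 : a ≤ 1) :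
    IntegrableOn (magneticDensity Ω (vortexPhase ℓ)) (perforatedDisc ℓ a) ∧
      ∫ z in perforatedDisc ℓ a, magneticDensity Ω (vortexPhase ℓ) z
        ≤ Real.pi / 2 * (Real.pi / ℓ ^ 2 - Ω / 2) ^ 2
          + ((∫ z in perforatedDisc ℓ a, ‖vortexField hℓ z‖ ^ 2)
            + 2 * |Real.pi / ℓ ^ 2 - Ω / 2| * (65 * Real.pi ^ 2
              + (2 * Real.pi ^ 3 * a / ℓ ^ 4 + 2 * Real.pi ^ 2 * a / ℓ ^ 2))) := by
  set Λ := perforatedDisc ℓ a with hΛ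
  set c := Real.pi / ℓ ^ 2 - Ω / 2 with hc
  have hΛm : MeasurableSet Λ := measurableSet_perforatedDisc hℓ a
  have hΛb : Λ ⊆ Metric.ball (0 : ℂ) 1 := perforatedDisc_subset_ball ℓ a
  have hpt : ∀ z ∈ Λ, magneticDensity Ω (vortexPhase ℓ) z = ‖vortexField hℓ z‖ ^ 2
      + 2 * c * (z * vortexField hℓ z).re + c ^ 2 * ‖z‖ ^ 2 := by
    intro z hz
    refine magneticDensity_vortexPhase_eq Ω hℓ fun hzL => ?_
    have := le_norm_sub_of_mem_perforatedDisc hzL hz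
    rw [sub_self, norm_zero] at this
    linarith
  obtain ⟨hzf, hf⟩ := integrableOn_ball_mul_vortexField hℓ
  have hi1 : IntegrableOn (fun z => ‖vortexField hℓ z‖ ^ 2) Λ := by
    refine Measure.integrableOn_of_bounded
      (M := ((vortexLattice_finite hℓ).toFinset.card * a⁻¹ + Real.pi / ℓ ^ 2) ^ 2)
      (volume_perforatedDisc_lt_top ℓ a).ne
      ((measurable_vortexField hℓ).norm.pow_const 2).aestronglyMeasurable ?_
    refine (ae_restrict_iff' hΛm).2 (Filter.Eventually.of_forall fun z hz => ?_)
    rw [Real.norm_of_nonneg (by positivity)]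
    have := norm_vortexField_le_of_mem_perforatedDisc hℓ ha hz
    gcongr
  have hi2 : IntegrableOn (fun z => (z * vortexField hℓ z).re) Λ := (hzf.mono_set hΛb).re
  have hi3 : IntegrableOn (fun z : ℂ => ‖z‖ ^ 2) Λ :=
    (integrableOn_ball_of_continuous (by fun_prop)).mono_set hΛb
  have hi12 : IntegrableOn (fun z => ‖vortexField hℓ z‖ ^ 2
      + 2 * c * (z * vortexField hℓ z).re) Λ := hi1.add (hi2.const_mul _)
  have hi123 : IntegrableOn (fun z => ‖vortexField hℓ z‖ ^ 2
      + 2 * c * (z * vortexField hℓ z).re + c ^ 2 * ‖z‖ ^ 2) Λ := hi12.add (hi3.const_mul _)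
  refine ⟨hi123.congr_fun (fun z hz => (hpt z hz).symm) hΛm, ?_⟩
  rw [setIntegral_congr_fun hΛm hpt, integral_add hi12 (hi3.const_mul _),
    integral_add hi1 (hi2.const_mul _), integral_const_mul, integral_const_mul]
  have hcross : |∫ z in Λ, (z * vortexField hℓ z).re|
      ≤ 65 * Real.pi ^ 2 + (2 * Real.pi ^ 3 * a / ℓ ^ 4 + 2 * Real.pi ^ 2 * a / ℓ ^ 2) := by
    have hre : ∫ z in Λ, (z * vortexField hℓ z).re = (∫ z in Λ, z * vortexField hℓ z).re :=
      Complex.reCLM.integral_comp_comm (hzf.mono_set hΛb)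
    have hsplit := integral_inter_add_sdiff hΛm hzf
    rw [Set.inter_eq_right.2 hΛb] at hsplit
    have hholes : ‖∫ z in Metric.ball (0 : ℂ) 1 \ Λ, z * vortexField hℓ z‖
        ≤ 2 * Real.pi ^ 3 * a / ℓ ^ 4 + 2 * Real.pi ^ 2 * a / ℓ ^ 2 := by
      refine le_trans ?_ (setIntegral_holes_norm_vortexField_le hℓ ha ha1)
      refine (norm_integral_le_integral_norm _).trans ?_
      refine setIntegral_mono_on (hzf.mono_set Set.sdiff_subset).norm
        (hf.mono_set Set.sdiff_subset).norm (measurableSet_ball.diff hΛm) fun z hz => ?_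
      rw [norm_mul]
      exact mul_le_of_le_one_left (norm_nonneg _) (mem_ball_zero_iff.1 hz.1).le
    -- The moment over the perforated disc is that over the full disc, which is explicit, minus that
    -- over the holes.
    rw [hre, eq_sub_of_add_eq hsplit]
    exact (Complex.abs_re_le_norm _).trans ((norm_sub_le _ _).trans
      (add_le_add (norm_setIntegral_ball_mul_vortexField_le hℓ hℓ8) hholes))
  have hmass : ∫ z in Λ, ‖z‖ ^ 2 ≤ Real.pi / 2 := by
    rw [← setIntegral_ball_norm_sq]
    exact setIntegral_mono_set (integrableOn_ball_of_continuous (by fun_prop))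
      (Filter.Eventually.of_forall fun z => by positivity) (Filter.Eventually.of_forall hΛb)
  have h1 : 2 * c * ∫ z in Λ, (z * vortexField hℓ z).re
      ≤ 2 * |c| * (65 * Real.pi ^ 2
        + (2 * Real.pi ^ 3 * a / ℓ ^ 4 + 2 * Real.pi ^ 2 * a / ℓ ^ 2)) := by
    rw [mul_assoc, mul_assoc]
    refine mul_le_mul_of_nonneg_left ?_ zero_le_two
    refine (le_abs_self _).trans ?_
    rw [abs_mul]
    gcongr
  have h2 : c ^ 2 * ∫ z in Λ, ‖z‖ ^ 2 ≤ Real.pi / 2 * c ^ 2 := by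
    rw [mul_comm]
    gcongr
  linarith

theorem mainTheorem10 (Ω₀ δ : ℝ) (hΩ₀ : 0 < Ω₀) (hδ : 0 < δ) :
    ∃ C : ℝ, 0 < C ∧ ∃ ε₀ : ℝ, 0 < ε₀ ∧ ∀ η : ℝ, 5 / 2 < η → ∀ ε : ℝ, 0 < ε → ε < ε₀ →
      IntegrableOn (magneticDensity (Ω₀ / ε) (vortexPhase (δ * √ε)))
        (perforatedDisc (δ * √ε) (ε ^ η)) ∧
      ∫ z in perforatedDisc (δ * √ε) (ε ^ η),
          magneticDensity (Ω₀ / ε) (vortexPhase (δ * √ε)) z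
        ≤ Real.pi / (2 * ε ^ 2) * (Ω₀ / 2 - Real.pi / δ ^ 2) ^ 2
          + C * η * |Real.log ε| / ε := by
  obtain ⟨K, hK0, hK⟩ := exists_setIntegral_vortexField_sq_le
  set c₀ : ℝ := Real.pi / δ ^ 2 - Ω₀ / 2 with hc₀
  set H : ℝ := 65 * Real.pi ^ 2 + (2 * Real.pi ^ 3 / δ ^ 4 + 2 * Real.pi ^ 2 / δ ^ 2) with hH
  have hpi := Real.pi_pos
  -- The summands of `C` come from the energy and the cross term; the 1 makes `C` positive. In `ε₀`,
  -- `exp (-1)` gives `|log ε| > 1`, so bounded terms are absorbed by `η |log ε|`; `1 / (64 δ²)`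
  -- gives `ℓ ≤ 1 / 8`; `δ / 2` gives `a ≤ ℓ / 2`.
  refine ⟨2 * K / δ ^ 2 + 2 * |c₀| * H + 1, by positivity,
    min (Real.exp (-1)) (min (1 / (64 * δ ^ 2)) (δ / 2)), by positivity,
    fun η hη ε hε hεlt => ?_⟩
  obtain ⟨hεe, hεlt'⟩ := lt_min_iff.1 hεlt
  obtain ⟨hεδ, hεδ2⟩ := lt_min_iff.1 hεlt'
  have hlog : Real.log ε < -1 := (Real.log_lt_iff_lt_exp hε).2 hεe
  have hε1 : ε < 1 := hεe.trans (Real.exp_lt_one_iff.2 (by norm_num))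
  have hsq : √ε ^ 2 = ε := Real.sq_sqrt hε.le
  have hs0 : 0 < √ε := Real.sqrt_pos.2 hε
  have hℓ : 0 < δ * √ε := by positivity
  have hℓsq : (δ * √ε) ^ 2 = δ ^ 2 * ε := by rw [mul_pow, hsq]
  have hℓ8 : δ * √ε ≤ 1 / 8 := by
    refine abs_le_of_sq_le_sq' ?_ (by norm_num) |>.2
    rw [hℓsq]
    rw [lt_div_iff₀ (by positivity)] at hεδ
    linarith
  have ha : 0 < ε ^ η := Real.rpow_pos_of_pos hε η
  -- This is where `η > 5/2` enters: the factor `√ε` compares the holes with `ℓ`, and the remaining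
  -- `ε²` compensates `ℓ⁻⁴`, with constants independent of `η`.
  have hale : ε ^ η ≤ ε ^ 2 * √ε := by
    have h1 : ε ^ η ≤ ε ^ (5 / 2 : ℝ) := Real.rpow_le_rpow_of_exponent_ge hε hε1.le hη.le
    have h2 : ε ^ (5 / 2 : ℝ) = ε ^ 2 * √ε := by
      rw [Real.sqrt_eq_rpow, ← Real.rpow_natCast ε 2, ← Real.rpow_add hε]
      norm_num
    exact h1.trans_eq h2
  have hs1 : √ε ≤ 1 := Real.sqrt_le_one.2 hε1.le
  have ha2 : ε ^ η ≤ ε ^ 2 := hale.trans (mul_le_of_le_one_right (by positivity) hs1)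
  have ha1 : ε ^ η ≤ 1 := ha2.trans (by nlinarith)
  have haℓ : ε ^ η ≤ δ * √ε / 2 := by
    refine hale.trans ?_
    have : ε ^ 2 ≤ δ / 2 := by nlinarith
    calc ε ^ 2 * √ε ≤ δ / 2 * √ε := by gcongr
      _ = _ := by ring
  obtain ⟨hint, hle⟩ := setIntegral_magneticDensity_vortexPhase_le (Ω₀ / ε) hℓ hℓ8 ha ha1
  refine ⟨hint, hle.trans ?_⟩
  have hcε : Real.pi / (δ * √ε) ^ 2 - Ω₀ / ε / 2 = c₀ / ε := by
    rw [hℓsq, hc₀]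
    field_simp
  have habs : |Real.log ε| = -Real.log ε := abs_of_neg (by linarith)
  set M : ℝ := η * |Real.log ε| with hM
  have hM1 : 1 ≤ M := by
    rw [hM, habs]
    nlinarith
  have hE : ∫ z in perforatedDisc (δ * √ε) (ε ^ η), ‖vortexField hℓ z‖ ^ 2
      ≤ 2 * K / δ ^ 2 * M / ε := by
    refine (hK (δ * √ε) hℓ (ε ^ η) hℓ8 ha haℓ).trans ?_
    have h1 : Real.log (δ * √ε / (2 * ε ^ η)) ≤ M := by
      have h2 : δ * √ε / (2 * ε ^ η) ≤ (ε ^ η)⁻¹ := by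
        rw [div_le_iff₀ (by positivity)]
        field_simp
        linarith
      refine (Real.log_le_log (by positivity) h2).trans_eq ?_
      rw [Real.log_inv, Real.log_rpow hε, hM, habs]
      ring
    calc K / (δ * √ε) ^ 2 * (1 + Real.log (δ * √ε / (2 * ε ^ η)))
        ≤ K / (δ * √ε) ^ 2 * (2 * M) := by
          gcongr
          linarith
      _ = 2 * K / δ ^ 2 * M / ε := by
          rw [hℓsq]
          field_simp
  have hH' : 65 * Real.pi ^ 2 + (2 * Real.pi ^ 3 * ε ^ η / (δ * √ε) ^ 4
      + 2 * Real.pi ^ 2 * ε ^ η / (δ * √ε) ^ 2) ≤ H := by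
    have h4 : (δ * √ε) ^ 4 = δ ^ 4 * ε ^ 2 := by
      calc (δ * √ε) ^ 4 = ((δ * √ε) ^ 2) ^ 2 := by ring
        _ = _ := by rw [hℓsq]; ring
    rw [h4, hℓsq, hH]
    have e1 : 2 * Real.pi ^ 3 * ε ^ η / (δ ^ 4 * ε ^ 2) ≤ 2 * Real.pi ^ 3 / δ ^ 4 := by
      calc 2 * Real.pi ^ 3 * ε ^ η / (δ ^ 4 * ε ^ 2)
          ≤ 2 * Real.pi ^ 3 * ε ^ 2 / (δ ^ 4 * ε ^ 2) := by gcongr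
        _ = _ := by field_simp
    have e2 : 2 * Real.pi ^ 2 * ε ^ η / (δ ^ 2 * ε) ≤ 2 * Real.pi ^ 2 / δ ^ 2 := by
      have : ε ^ η ≤ ε := ha2.trans (by nlinarith)
      calc 2 * Real.pi ^ 2 * ε ^ η / (δ ^ 2 * ε)
          ≤ 2 * Real.pi ^ 2 * ε / (δ ^ 2 * ε) := by gcongr
        _ = _ := by field_simp
    linarith
  have hcross : 2 * |c₀ / ε| * (65 * Real.pi ^ 2 + (2 * Real.pi ^ 3 * ε ^ η / (δ * √ε) ^ 4
      + 2 * Real.pi ^ 2 * ε ^ η / (δ * √ε) ^ 2)) ≤ 2 * |c₀| * H * M / ε := by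
    have hH0 : 0 ≤ H := by positivity
    rw [abs_div, abs_of_pos hε]
    calc _ ≤ 2 * (|c₀| / ε) * H := by gcongr
      _ = 2 * |c₀| * H * 1 / ε := by ring
      _ ≤ _ := by gcongr
  have hmain : Real.pi / 2 * (c₀ / ε) ^ 2
      = Real.pi / (2 * ε ^ 2) * (Ω₀ / 2 - Real.pi / δ ^ 2) ^ 2 := by
    rw [hc₀]
    field_simp
    ring
  have hone : 0 ≤ M / ε := by positivity
  have hC : (2 * K / δ ^ 2 + 2 * |c₀| * H + 1) * η * |Real.log ε| / ε
      = 2 * K / δ ^ 2 * M / ε + 2 * |c₀| * H * M / ε + M / ε := by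
    rw [hM]
    ring
  rw [hcε, hmain, hC]
  linarith
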